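/- Let $P\subset\mathbb{R}^n$ be a simplicial $4$-polytope, that is, a $4$-dimensional convex polytope all of whose facets are simplices. A \emph{deep vertex truncation} of $P$ is a set $$\mathrm{DVT}(P)\;=\;P\cap\bigcap_{v\in V(P)}H_v^-,$$ where $V(P)$ is the set of vertices of $P$ and, for each vertex $v$, $H_v^-$ is a closed halfspace not containing $v$, such that from each edge $e$ of $P$ exactly one point remains and this point lies in the relative interior of $e$ (that is, $\mathrm{DVT}(P)\cap e=\{p_e\}$ with $p_e$ in the relative interior of $e$). \textbf{Proposition (Paffenholz \& Ziegler).} Every deep vertex truncation $\mathrm{DVT}(P)$ of a simplicial $4$-polytope $P$ is a $2$-simple and $2$-simplicial $4$-polytope. That is, $\mathrm{DVT}(P)$ is a $4$-dimensional convex polytope, all its $2$-faces are triangles, and each of its edges lies in exactly three of its facets. -/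

import Mathlib

namespace Polytope

variable {E : Type*} [NormedAddCommGroup E] [NormedSpace ℝ E]

/-- The dimension of a (nonempty) convex set: the dimension of its affine hull. -/
noncomputable def dim (A : Set E) : ℕ := Module.finrank ℝ (vectorSpan ℝ A)

/-- `P` is a `d`-polytope: the convex hull of a finite nonempty set of points, of dimension `d`.
The affine hull of `P` need not be the whole space. -/
def IsPolytope (d : ℕ) (P : Set E) : Prop :=
  (∃ S : Set E, S.Finite ∧ S.Nonempty ∧ P = convexHull ℝ S) ∧ dim P = d

/-- `F` is a `k`-dimensional (nonempty) face of the polytope `P`: the set of all points of `P`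
at which some linear functional attains its maximum over `P`. -/
def IsFace (P : Set E) (k : ℕ) (F : Set E) : Prop :=
  F.Nonempty ∧ IsExposed ℝ P F ∧ dim F = k

/-- The vertices of `P`, i.e. the points `v` such that `{v}` is a face of `P`. -/
def vertices (P : Set E) : Set E := {v | IsFace P 0 {v}}

/-- `F` is a `k`-simplex: the convex hull of `k + 1` affinely independent points. -/
def IsSimplex (k : ℕ) (F : Set E) : Prop :=
  ∃ p : Fin (k + 1) → E, AffineIndependent ℝ p ∧ F = convexHull ℝ (Set.range p)

/-- All `k`-dimensional faces of `P` are simplices. -/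
def IsKSimplicial (k : ℕ) (P : Set E) : Prop :=
  ∀ F, IsFace P k F → IsSimplex k F

/-- A simplicial `d`-polytope: all facets (faces of dimension `d - 1`) are simplices. -/
def IsSimplicialPolytope (d : ℕ) (P : Set E) : Prop :=
  IsPolytope d P ∧ ∀ k, k + 1 = d → IsKSimplicial k P

/-- `P`, of dimension `d`, is `h`-simple: every face of dimension `d - 1 - h` lies in exactly
`h + 1` facets (the minimal possible number). For `d = 4` and `h = 2`: every edge lies in exactly
three facets. -/
def IsHSimple (d h : ℕ) (P : Set E) : Prop :=
  ∀ j k G, j + h + 1 = d → k + 1 = d → IsFace P j G → {F | IsFace P k F ∧ G ⊆ F}.ncard = h + 1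

/-- A closed halfspace of `E`. -/
def IsClosedHalfspace (H : Set E) : Prop :=
  ∃ (l : StrongDual ℝ E) (c : ℝ), l ≠ 0 ∧ H = {x | l x ≤ c}

/-- `Q` is a deep vertex truncation of `P`: it is obtained by cutting off every vertex `v` of `P`
by a closed halfspace `H v`, in such a way that exactly one point remains from each edge of `P`,
and that this point lies in the relative interior of the edge. -/
def IsDeepVertexTruncation (P Q : Set E) : Prop :=
  ∃ H : E → Set E,
    (∀ v ∈ vertices P, IsClosedHalfspace (H v) ∧ v ∉ H v) ∧
    Q = P ∩ ⋂ v ∈ vertices P, H v ∧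
    ∀ e, IsFace P 1 e → ∃ p ∈ intrinsicInterior ℝ e, Q ∩ e = {p}

end Polytope

/-! Let `V` be the vertex set of `P`, and let the hyperplane `l v = c v` cut off `v`. A functional
that is maximal at a vertex among its neighbours is maximal on all of `V`. Hence every other vertex
lies strictly inside the halfspace at `v`; since only one point of each edge survives, the
hyperplanes of both ends of an edge pass through its cut point.

The main device is a rotation (`IsTruncation.exists_supporting`). If `m ≤ μ` holds at all cut points
but `m v > μ`, adding a multiple of `l v - c v` changes nothing at the cut points next to `v` and
turns `m = μ` into a supporting hyperplane of `V` through `v`. It follows that the truncation is the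
hull of the cut points (`inter_eq_convexHull`), and that each of its faces comes from a face `F` of
`P` in one of two ways (`face_cases`): from all cut points on edges inside `F`, or from those on
edges of `F` at a vertex `v` of `F`.

Proper faces of `P` are simplices, so dimensions can be read off. A face of the first kind has the
dimension of `F` once `dim F ≥ 2`, and dimension 0 otherwise; one of the second kind has dimension
`dim F - 1`. The 2-faces thus come from triangles, or from tetrahedra seen from a vertex, with three
cut points in both cases. The facets come from the facets of `P` and from the vertices of `P`. An
edge is a triangle `F` seen from a vertex `v`; it lies in the facet of `v` and in the facets given
by the two facets of `P` through `F`. -/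

namespace Polytope

/-! ### Faces of a finite point set and the tilting of supporting hyperplanes -/

section FaceSets

variable {E : Type*} [NormedAddCommGroup E] [NormedSpace ℝ E]

/-- `A` is a nonempty subset of `V` cut out by a supporting hyperplane of `V`. -/
def IsFaceSet (V A : Set E) : Prop :=
  A.Nonempty ∧ ∃ (l : StrongDual ℝ E) (c : ℝ),
    (∀ x ∈ V, l x ≤ c) ∧ ∀ x, x ∈ A ↔ x ∈ V ∧ l x = c

theorem IsFaceSet.subset {V A : Set E} (h : IsFaceSet V A) : A ⊆ V := by
  obtain ⟨_, l, c, _, h⟩ := h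
  exact fun x hx => ((h x).1 hx).1

theorem isFaceSet_self {V : Set E} (hV : V.Nonempty) : IsFaceSet V V :=
  ⟨hV, 0, 0, by simp, by simp⟩

theorem vectorSpan_le_ker_iff {A : Set E} {f : E →ₗ[ℝ] ℝ} :
    vectorSpan ℝ A ≤ LinearMap.ker f ↔ ∀ x ∈ A, ∀ y ∈ A, f x = f y := by
  rw [vectorSpan_def, Submodule.span_le]
  constructor
  · intro h x hx y hy
    have := h (Set.vsub_mem_vsub hx hy)
    simpa [sub_eq_zero] using this
  · rintro h _ ⟨x, hx, y, hy, rfl⟩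
    simp [h x hx y hy]

theorem vectorSpan_le_iff_forall_dual [FiniteDimensional ℝ E] {A : Set E} {U : Submodule ℝ E}
    (h : ∀ f : StrongDual ℝ E, (∀ u ∈ U, f u = 0) → ∀ x ∈ A, ∀ y ∈ A, f x = f y) :
    vectorSpan ℝ A ≤ U := by
  intro w hw
  by_contra hwU
  obtain ⟨f, hf, hU⟩ := Submodule.exists_le_ker_of_notMem hwU
  have := vectorSpan_le_ker_iff.2 (h (LinearMap.toContinuousLinearMap f) fun u hu => hU hu) hw
  exact hf this

theorem exists_dual_of_not_vectorSpan_le [FiniteDimensional ℝ E] {A : Set E} {U : Submodule ℝ E}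
    (h : ¬ vectorSpan ℝ A ≤ U) :
    ∃ f : StrongDual ℝ E, (∀ u ∈ U, f u = 0) ∧ ∃ x ∈ A, ∃ y ∈ A, f x ≠ f y := by
  contrapose! h
  exact vectorSpan_le_iff_forall_dual h

theorem vectorSpan_convexHull (A : Set E) :
    vectorSpan ℝ (convexHull ℝ A) = vectorSpan ℝ A := by
  rw [← direction_affineSpan, affineSpan_convexHull, direction_affineSpan]

theorem dim_convexHull (A : Set E) : dim (convexHull ℝ A) = dim A := by
  rw [dim, dim, vectorSpan_convexHull]

theorem dim_singleton (x : E) : dim ({x} : Set E) = 0 := by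
  simp [dim]

theorem dim_mono [FiniteDimensional ℝ E] {A B : Set E} (h : A ⊆ B) : dim A ≤ dim B :=
  Submodule.finrank_mono (vectorSpan_mono ℝ h)

theorem IsFaceSet.dim_lt [FiniteDimensional ℝ E] {V A B : Set E} (hA : IsFaceSet V A)
    (hAB : A ⊂ B) (hB : B ⊆ V) : dim A < dim B := by
  obtain ⟨⟨a, ha⟩, l, c, hl, h⟩ := hA
  apply Submodule.finrank_lt_finrank_of_lt
  refine lt_of_le_of_ne (vectorSpan_mono ℝ hAB.1) fun heq => ?_
  have h1 : vectorSpan ℝ A ≤ LinearMap.ker l.toLinearMap :=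
    vectorSpan_le_ker_iff.2 fun x hx y hy => ((h x).1 hx).2.trans ((h y).1 hy).2.symm
  rw [heq, vectorSpan_le_ker_iff] at h1
  refine hAB.2 fun x hx => (h x).2 ⟨hB hx, ?_⟩
  exact (h1 x hx a (hAB.1 ha)).trans ((h a).1 ha).2

/-- Rotating a supporting hyperplane of `V` in the direction of `k` until it meets a new point. -/
theorem exists_tilt {V A : Set E} (hV : V.Finite) {l k : StrongDual ℝ E} {c d : ℝ}
    (hl : ∀ x ∈ V, l x ≤ c) (hA : ∀ x, x ∈ A ↔ x ∈ V ∧ l x = c)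
    (hk : ∀ x ∈ A, k x = d) (hne : A ≠ V) :
    ∃ r : ℝ, (∀ x ∈ V, (k + r • l) x ≤ d + r * c) ∧
      ∃ s ∈ V, s ∉ A ∧ (k + r • l) s = d + r * c := by
  have hVA : (V \ A).Nonempty := by
    rw [Set.sdiff_nonempty]
    exact fun h => hne (Set.Subset.antisymm (fun x hx => ((hA x).1 hx).1) h)
  -- Off `A` the required bound reads `(k x - d) / (c - l x) ≤ r`, so the largest ratio is the least
  -- admissible `r`, with equality at a maximizer.
  obtain ⟨s, ⟨hsV, hsA⟩, hmax⟩ :=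
    Set.exists_max_image (V \ A) (fun x => (k x - d) / (c - l x)) (hV.sdiff) hVA
  have hlt : ∀ x ∈ V, x ∉ A → 0 < c - l x := fun x hx hxA =>
    sub_pos.2 (lt_of_le_of_ne (hl x hx) fun h => hxA ((hA x).2 ⟨hx, h⟩))
  refine ⟨(k s - d) / (c - l s), fun x hx => ?_, s, hsV, hsA, ?_⟩
  · by_cases hxA : x ∈ A
    · simp [hk x hxA, ((hA x).1 hxA).2]
    · have := hmax x ⟨hx, hxA⟩
      rw [div_le_iff₀ (hlt x hx hxA)] at this
      simp only [add_apply, smul_apply, smul_eq_mul]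
      linarith
  · have := hlt s hsV hsA
    simp only [add_apply, smul_apply, smul_eq_mul]
    field_simp
    ring

theorem IsFaceSet.trans {V A B : Set E} (hV : V.Finite) (hA : IsFaceSet V A)
    (hB : IsFaceSet A B) : IsFaceSet V B := by
  obtain ⟨⟨a, ha⟩, l, c, hl, hA⟩ := hA
  obtain ⟨hBne, k, d, hk, hB⟩ := hB
  -- With `N` above all these ratios, `k + N • l` is strictly below its maximum off `A`, while on
  -- `A` it differs from `k` by a constant.
  obtain ⟨N, hN⟩ : ∃ N : ℝ, ∀ x ∈ V, x ∉ A → (k x - d) / (c - l x) < N := by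
    obtain ⟨N, hN⟩ := (hV.image fun x => (k x - d) / (c - l x)).bddAbove
    exact ⟨N + 1, fun x hx _ => (hN (Set.mem_image_of_mem _ hx)).trans_lt (by linarith)⟩
  have hlt : ∀ x ∈ V, x ∉ A → k x + N * l x < d + N * c := fun x hx hxA => by
    have h1 : 0 < c - l x :=
      sub_pos.2 (lt_of_le_of_ne (hl x hx) fun h => hxA ((hA x).2 ⟨hx, h⟩))
    have := hN x hx hxA
    rw [div_lt_iff₀ h1] at this
    linarith
  refine ⟨hBne, k + N • l, d + N * c, fun x hx => ?_, fun x => ⟨fun hx => ?_, ?_⟩⟩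
  · by_cases hxA : x ∈ A
    · simpa [((hA x).1 hxA).2] using hk x hxA
    · simpa using (hlt x hx hxA).le
  · have hxB := (hB x).1 hx
    have hxA := (hA x).1 hxB.1
    exact ⟨hxA.1, by simp [hxA.2, hxB.2]⟩
  · rintro ⟨hx, h⟩
    simp only [add_apply, smul_apply, smul_eq_mul] at h
    by_cases hxA : x ∈ A
    · refine (hB x).2 ⟨hxA, ?_⟩
      rw [((hA x).1 hxA).2] at h
      linarith
    · exact absurd h (hlt x hx hxA).ne

theorem IsFaceSet.mono {V A B : Set E} (hA : IsFaceSet V A) (hAB : A ⊆ B) (hB : B ⊆ V) :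
    IsFaceSet B A := by
  obtain ⟨hne, l, c, hl, h⟩ := hA
  exact ⟨hne, l, c, fun x hx => hl x (hB hx),
    fun x => ⟨fun hx => ⟨hAB hx, ((h x).1 hx).2⟩, fun hx => (h x).2 ⟨hB hx.1, hx.2⟩⟩⟩

/-- A functional constant on a face of codimension at least two and on a further point, but not
on all of `V`. -/
theorem IsFaceSet.exists_dual [FiniteDimensional ℝ E] {V A : Set E} (hA : IsFaceSet V A)
    (hd : dim A + 2 ≤ dim V) :
    ∃ (k : StrongDual ℝ E) (d : ℝ), (∀ x ∈ A, k x = d) ∧ (∃ s ∈ V, s ∉ A ∧ k s = d) ∧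
      ∃ t ∈ V, t ∉ A ∧ k t ≠ d := by
  obtain ⟨a, ha⟩ := hA.1
  have hAV : A ⊂ V := by
    refine lt_of_le_of_ne hA.subset fun h => ?_
    rw [h] at hd
    omega
  obtain ⟨s, hs, hsA⟩ := Set.exists_of_ssubset hAV
  have hU : ¬ vectorSpan ℝ V ≤ vectorSpan ℝ A ⊔ Submodule.span ℝ {s - a} := by
    intro hle
    have h1 := Submodule.finrank_mono hle
    have h2 := Submodule.finrank_add_le_finrank_add_finrank (vectorSpan ℝ A)
      (Submodule.span ℝ {s - a})
    have h3 := finrank_span_le_card (R := ℝ) ({s - a} : Set E)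
    simp only [Set.toFinset_singleton, Finset.card_singleton] at h3
    unfold dim at hd
    omega
  obtain ⟨k, hk, x, hx, y, hy, hxy⟩ := exists_dual_of_not_vectorSpan_le hU
  have hkA : ∀ x ∈ A, k x = k a := fun x hx => by
    have := hk (x - a) (Submodule.mem_sup_left (vsub_mem_vectorSpan ℝ hx ha))
    simpa [sub_eq_zero] using this
  have hks : k s = k a := by
    have := hk (s - a) (Submodule.mem_sup_right (Submodule.mem_span_singleton_self _))
    simpa [sub_eq_zero] using this
  refine ⟨k, k a, hkA, ⟨s, hs, hsA, hks⟩, ?_⟩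
  by_contra! hall
  have hV : ∀ t ∈ V, k t = k a := fun t ht => by
    by_cases htA : t ∈ A
    · exact hkA t htA
    · exact hall t ht htA
  exact hxy ((hV x hx).trans (hV y hy).symm)

/-- The two witnesses keep the tilted face proper: equality at `s` would force `r = 0`, and then
equality at `t` would give `k t = d`. -/
theorem IsFaceSet.exists_larger_proper [FiniteDimensional ℝ E] {V A : Set E} (hV : V.Finite)
    {l k : StrongDual ℝ E} {c d : ℝ} (hne : A.Nonempty)
    (hl : ∀ x ∈ V, l x ≤ c) (hA : ∀ x, x ∈ A ↔ x ∈ V ∧ l x = c)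
    (hk : ∀ x ∈ A, k x = d) (hs : ∃ s ∈ V, s ∉ A ∧ k s = d) (ht : ∃ t ∈ V, t ∉ A ∧ k t ≠ d) :
    ∃ r : ℝ, (∀ x ∈ V, (k + r • l) x ≤ d + r * c) ∧
      IsFaceSet V {x ∈ V | (k + r • l) x = d + r * c} ∧
      A ⊂ {x ∈ V | (k + r • l) x = d + r * c} ∧ {x ∈ V | (k + r • l) x = d + r * c} ⊂ V := by
  obtain ⟨s, hsV, hsA, hs⟩ := hs
  obtain ⟨t, htV, htA, ht⟩ := ht
  obtain ⟨r, hr, y, hy, hyA, hyr⟩ := exists_tilt hV hl hA hk (fun h => hsA (h ▸ hsV))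
  have hsub : A ⊆ {x ∈ V | (k + r • l) x = d + r * c} := fun x hx =>
    ⟨((hA x).1 hx).1, by simp [hk x hx, ((hA x).1 hx).2]⟩
  refine ⟨r, hr, ⟨hne.mono hsub, _, _, hr, fun x => Iff.rfl⟩,
    ⟨hsub, fun h => hyA (h ⟨hy, hyr⟩)⟩, fun x hx => hx.1, fun h => ?_⟩
  have h1 := (h hsV).2
  have h2 := (h htV).2
  simp only [add_apply, smul_apply, smul_eq_mul, hs]
    at h1 h2
  have h3 : r * (l s - c) = 0 := by linarith
  rcases mul_eq_zero.1 h3 with h3 | h3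
  · apply ht
    rw [h3] at h2
    linarith
  · exact hsA ((hA s).2 ⟨hsV, by linarith⟩)

theorem IsFaceSet.exists_facet [FiniteDimensional ℝ E] {V A : Set E} (hV : V.Finite)
    (hA : IsFaceSet V A) (hne : A ≠ V) : ∃ B, IsFaceSet V B ∧ A ⊆ B ∧ dim B + 1 = dim V := by
  induction hn : dim V - dim A using Nat.strong_induction_on generalizing A with
  | _ n ih =>
    have hlt := hA.dim_lt (lt_of_le_of_ne hA.subset hne) subset_rfl
    by_cases hd : dim A + 1 = dim V
    · exact ⟨A, hA, subset_rfl, hd⟩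
    · obtain ⟨k, d, hk, hs, ht⟩ := hA.exists_dual (by omega)
      obtain ⟨l, c, hl, h⟩ := hA.2
      obtain ⟨r, -, hB, hAB, hBV⟩ := IsFaceSet.exists_larger_proper hV hA.1 hl h hk hs ht
      have := hA.dim_lt hAB hBV.1
      obtain ⟨B', hB', hsub, hdim⟩ := ih _ (by omega) hB hBV.ne rfl
      exact ⟨B', hB', hAB.1.trans hsub, hdim⟩

/-- Modulo constants, the functionals on `V` that are constant on a codimension-one subset form a
line. -/
theorem eq_smul_of_vectorSpan_le_ker [FiniteDimensional ℝ E] {V B : Set E}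
    (hB : B ⊆ V) (hd : dim B + 1 = dim V) {f g : StrongDual ℝ E} {b : E} (hb : b ∈ B)
    (hf : ∀ x ∈ B, f x = f b) (hg : ∀ x ∈ B, g x = g b) (hfV : ∃ x ∈ V, f x ≠ f b) :
    ∃ γ : ℝ, ∀ x ∈ V, g x - g b = γ * (f x - f b) := by
  obtain ⟨z, hz, hzf⟩ := hfV
  refine ⟨(g z - g b) / (f z - f b), ?_⟩
  have hz0 : f z - f b ≠ 0 := sub_ne_zero.2 hzf
  set γ := (g z - g b) / (f z - f b)
  let h : StrongDual ℝ E := g - γ • f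
  have hhz : h z = h b := by
    have : γ * (f z - f b) = g z - g b := div_mul_cancel₀ _ hz0
    simp only [h, sub_apply, smul_apply, smul_eq_mul]
    linarith
  have hhB : ∀ x ∈ B, h x = h b := fun x hx => by simp [h, hf x hx, hg x hx]
  have hlt : vectorSpan ℝ B < vectorSpan ℝ (insert z B) := by
    refine lt_of_le_of_ne (vectorSpan_mono ℝ (Set.subset_insert _ _)) fun heq => ?_
    have h1 : vectorSpan ℝ B ≤ LinearMap.ker f.toLinearMap :=
      vectorSpan_le_ker_iff.2 fun x hx y hy => (hf x hx).trans (hf y hy).symm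
    rw [heq, vectorSpan_le_ker_iff] at h1
    exact hzf (h1 z (Set.mem_insert _ _) b (Set.mem_insert_of_mem _ hb))
  have heq : vectorSpan ℝ (insert z B) = vectorSpan ℝ V := by
    apply Submodule.eq_of_le_of_finrank_le (vectorSpan_mono ℝ (Set.insert_subset hz hB))
    have := Submodule.finrank_lt_finrank_of_lt hlt
    unfold dim at hd
    omega
  have h1 : vectorSpan ℝ (insert z B) ≤ LinearMap.ker h.toLinearMap := by
    have h2 : ∀ x ∈ insert z B, h x = h b := by
      rintro x (rfl | hx)
      exacts [hhz, hhB x hx]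
    exact vectorSpan_le_ker_iff.2 fun x hx y hy => (h2 x hx).trans (h2 y hy).symm
  rw [heq, vectorSpan_le_ker_iff] at h1
  intro x hx
  have := h1 x hx b (hB hb)
  simp only [h, ContinuousLinearMap.coe_coe, sub_apply,
    smul_apply, smul_eq_mul] at this
  linarith

theorem IsFaceSet.mem_iff_and_le_or_ge_of_facet [FiniteDimensional ℝ E] {V B : Set E}
    (hB : IsFaceSet V B) (hd : dim B + 1 = dim V) {f : StrongDual ℝ E} {c : ℝ}
    (hf : ∀ x ∈ B, f x = c) (hfV : ∃ x ∈ V, f x ≠ c) :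
    (∀ x, x ∈ B ↔ x ∈ V ∧ f x = c) ∧ ((∀ x ∈ V, f x ≤ c) ∨ ∀ x ∈ V, c ≤ f x) := by
  obtain ⟨⟨b, hb⟩, m, μ, hm, h⟩ := id hB
  have hbc := hf b hb
  have hbm := ((h b).1 hb).2
  obtain ⟨γ, hγ⟩ := eq_smul_of_vectorSpan_le_ker hB.subset hd hb
    (fun x hx => (hf x hx).trans hbc.symm) (g := m)
    (fun x hx => ((h x).1 hx).2.trans hbm.symm) (by rwa [hbc])
  rw [hbc, hbm] at hγ
  have hγ0 : γ ≠ 0 := by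
    rintro rfl
    have : B = V := by
      refine Set.Subset.antisymm hB.subset fun x hx => (h x).2 ⟨hx, ?_⟩
      have := hγ x hx
      linarith
    rw [this] at hd
    omega
  refine ⟨fun x => ⟨fun hx => ⟨hB.subset hx, hf x hx⟩, fun hx => (h x).2 ⟨hx.1, ?_⟩⟩, ?_⟩
  · have := hγ x hx.1
    rw [hx.2] at this
    linarith
  · rcases lt_or_gt_of_ne hγ0 with h0 | h0
    · right
      intro x hx
      have h1 := hγ x hx
      have h2 := hm x hx
      by_contra! h3
      nlinarith
    · left
      intro x hx
      have h1 := hγ x hx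
      have h2 := hm x hx
      by_contra! h3
      nlinarith

/-- The diamond property: a face of codimension two lies in exactly two facets. -/
theorem IsFaceSet.exists_two_facets [FiniteDimensional ℝ E] {V A : Set E} (hV : V.Finite)
    (hA : IsFaceSet V A) (hd : dim A + 2 = dim V) :
    ∃ B₁ B₂, B₁ ≠ B₂ ∧
      ∀ B, (IsFaceSet V B ∧ dim B + 1 = dim V ∧ A ⊆ B) ↔ B = B₁ ∨ B = B₂ := by
  obtain ⟨k, d, hk, ⟨s, hs, hsA, hks⟩, ⟨t, ht, htA, hkt⟩⟩ := hA.exists_dual hd.le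
  obtain ⟨l, c, hl, h⟩ := hA.2
  obtain ⟨r₁, hr₁, hB₁, hAB₁, hBV₁⟩ := IsFaceSet.exists_larger_proper hV hA.1 hl h hk
    ⟨s, hs, hsA, hks⟩ ⟨t, ht, htA, hkt⟩
  obtain ⟨r₂, hr₂, hB₂, hAB₂, hBV₂⟩ := IsFaceSet.exists_larger_proper (k := -k) (d := -d) hV hA.1 hl h
    (fun x hx => by simp [hk x hx]) ⟨s, hs, hsA, by simp [hks]⟩ ⟨t, ht, htA, by simpa using hkt⟩
  have hd₁ : dim {x ∈ V | (k + r₁ • l) x = d + r₁ * c} + 1 = dim V := by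
    have h1 := hA.dim_lt hAB₁ hBV₁.1
    have h2 := hB₁.dim_lt hBV₁ subset_rfl
    omega
  have hd₂ : dim {x ∈ V | (-k + r₂ • l) x = -d + r₂ * c} + 1 = dim V := by
    have h1 := hA.dim_lt hAB₂ hBV₂.1
    have h2 := hB₂.dim_lt hBV₂ subset_rfl
    omega
  have hlt : ∀ x ∈ V, x ∉ A → l x < c := fun x hx hxA =>
    lt_of_le_of_ne (hl x hx) fun h' => hxA ((h x).2 ⟨hx, h'⟩)
  refine ⟨{x ∈ V | (k + r₁ • l) x = d + r₁ * c}, {x ∈ V | (-k + r₂ • l) x = -d + r₂ * c},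
    fun heq => ?_, fun B => ⟨?_, ?_⟩⟩
  -- If the tilts towards `k` and `-k` met the same face, adding the equations at `y` gives `r₁ + r₂
  -- = 0`, the bounds at `s` give `r₁ = 0`, and those at `t` give `k t = d`.
  · obtain ⟨y, hy, hyA⟩ := Set.exists_of_ssubset hAB₁
    have hy2 := hy
    rw [heq] at hy2
    obtain ⟨hyV, hy1⟩ := hy
    obtain ⟨-, hy2⟩ := hy2
    have hs1 := hr₁ s hs
    have hs2 := hr₂ s hs
    have ht1 := hr₁ t ht
    have ht2 := hr₂ t ht
    simp only [add_apply, smul_apply, smul_eq_mul,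
      neg_apply] at hy1 hy2 hs1 hs2 ht1 ht2
    have hly := hlt y hyV hyA
    have hls := hlt s hs hsA
    have hlt' := hlt t ht htA
    have h12 : (r₁ + r₂) * (l y - c) = 0 := by linarith
    have h3 : r₁ + r₂ = 0 := by
      rcases mul_eq_zero.1 h12 with h3 | h3
      · exact h3
      · linarith
    obtain rfl : r₂ = -r₁ := by linarith
    have h4 : r₁ * (l s - c) = 0 := by linarith
    have h5 : r₁ = 0 := by
      rcases mul_eq_zero.1 h4 with h3 | h3
      · exact h3
      · linarith
    subst h5
    exact hkt (by linarith)
  · rintro ⟨hB, hdB, hAB⟩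
    obtain ⟨x, hx, hxA⟩ : ∃ x ∈ B, x ∉ A := by
      by_contra! hsub
      rw [Set.Subset.antisymm hAB hsub] at hd
      omega
    have hxV := hB.subset hx
    have hlx := hlt x hxV hxA
    -- Hyperplanes of the pencil `k + r • l = d + r * c` all contain `A`; this `r` makes one pass
    -- through `x`, hence through all of `B`.
    set r := (k x - d) / (c - l x) with hr
    have hrx : r * (c - l x) = k x - d := div_mul_cancel₀ _ (by linarith)
    obtain ⟨a, ha⟩ := hA.1
    have hspan : vectorSpan ℝ (insert x A) = vectorSpan ℝ B := by
      apply Submodule.eq_of_le_of_finrank_le (vectorSpan_mono ℝ (Set.insert_subset hx hAB))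
      have := hA.dim_lt (B := insert x A) (Set.ssubset_insert hxA)
        (Set.insert_subset hxV hA.subset)
      unfold dim at *
      omega
    have hc : ∀ y ∈ B, (k + r • l) y = d + r * c := by
      have h1 : ∀ y ∈ insert x A, (k + r • l) y = d + r * c := by
        rintro y (rfl | hy)
        · simp only [add_apply, smul_apply, smul_eq_mul]
          linarith
        · simp [hk y hy, ((h y).1 hy).2]
      have h2 : vectorSpan ℝ (insert x A) ≤ LinearMap.ker (k + r • l).toLinearMap :=
        vectorSpan_le_ker_iff.2 fun y hy z hz => (h1 y hy).trans (h1 z hz).symm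
      rw [hspan, vectorSpan_le_ker_iff] at h2
      exact fun y hy => (h2 y hy x hx).trans (h1 x (Set.mem_insert _ _))
    have hnc : ∃ y ∈ V, (k + r • l) y ≠ d + r * c := by
      by_contra! hall
      have h1 := hall s hs
      have h2 := hall t ht
      simp only [add_apply, smul_apply, smul_eq_mul,
        hks] at h1 h2
      have h4 : r * (l s - c) = 0 := by linarith
      have h5 : r = 0 := by
        rcases mul_eq_zero.1 h4 with h3 | h3
        · exact h3
        · linarith [hlt s hs hsA]
      rw [h5] at h2
      exact hkt (by linarith)
    obtain ⟨hBiff, hside⟩ := hB.mem_iff_and_le_or_ge_of_facet hdB hc hnc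
    -- The side of the hyperplane on which `V` lies tells which of the two extreme slopes `r` must
    -- be.
    rcases hside with hle | hge
    · left
      have : r = r₁ := by
        obtain ⟨y, ⟨hy, hy1⟩, hyA⟩ := Set.exists_of_ssubset hAB₁
        have h1 := hle y hy
        have h2 := hr₁ x hxV
        have h3 := hlt y hy hyA
        simp only [add_apply, smul_apply, smul_eq_mul]
          at h1 h2 hy1
        apply le_antisymm
        · by_contra! h4
          nlinarith [mul_pos (sub_pos.2 h4) (sub_pos.2 hlx)]
        · by_contra! h4
          nlinarith [mul_pos (sub_pos.2 h4) (sub_pos.2 h3)]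
      rw [← this]
      exact Set.ext hBiff
    · right
      have : r = -r₂ := by
        obtain ⟨y, ⟨hy, hy1⟩, hyA⟩ := Set.exists_of_ssubset hAB₂
        have h1 := hge y hy
        have h2 := hr₂ x hxV
        have h3 := hlt y hy hyA
        simp only [add_apply, smul_apply, smul_eq_mul,
          neg_apply] at h1 h2 hy1
        apply le_antisymm
        · by_contra! h4
          nlinarith [mul_pos (sub_pos.2 h4) (sub_pos.2 h3)]
        · by_contra! h4
          nlinarith [mul_pos (sub_pos.2 h4) (sub_pos.2 hlx)]
      ext y
      rw [hBiff y, this]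
      simp only [add_apply, smul_apply, smul_eq_mul,
        neg_apply, Set.mem_ofPred_eq]
      exact and_congr_right fun _ => ⟨fun h => by linarith, fun h => by linarith⟩
  · rintro (rfl | rfl)
    · exact ⟨hB₁, hd₁, hAB₁.1⟩
    · exact ⟨hB₂, hd₂, hAB₂.1⟩

end FaceSets

/-! ### Edges, local maxima and global maxima -/

section Edges

variable {E : Type*} [NormedAddCommGroup E] [NormedSpace ℝ E]

/-- `v` and `w` are the two ends of an edge of the convex hull of `V`. -/
def Adj (V : Set E) (v w : E) : Prop := v ≠ w ∧ IsFaceSet V {v, w}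

theorem Adj.symm {V : Set E} {v w : E} (h : Adj V v w) : Adj V w v :=
  ⟨h.1.symm, Set.pair_comm v w ▸ h.2⟩

theorem Adj.left_mem {V : Set E} {v w : E} (h : Adj V v w) : v ∈ V := h.2.subset (by simp)

theorem Adj.right_mem {V : Set E} {v w : E} (h : Adj V v w) : w ∈ V := h.2.subset (by simp)

/-- Every element of `V` is a vertex of the convex hull of `V`. -/
def IsVertexSet (V : Set E) : Prop := ∀ v ∈ V, IsFaceSet V {v}

theorem IsVertexSet.exists_dual_lt {V : Set E} (hV : IsVertexSet V) {v : E} (hv : v ∈ V) :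
    ∃ l : StrongDual ℝ E, ∀ x ∈ V, x ≠ v → l x < l v := by
  obtain ⟨_, l, c, hl, h⟩ := hV v hv
  refine ⟨l, fun x hx hxv => ?_⟩
  rw [((h v).1 rfl).2]
  exact lt_of_le_of_ne (hl x hx) fun h' => hxv ((h x).2 ⟨hx, h'⟩)

/-- If `t - v = c • (s - v)`, functionals peaking at `v`, `s` and `t` give `c > 0`, `c < 1` and `c >
1` respectively. -/
theorem IsVertexSet.notMem_span {V : Set E} (hV : IsVertexSet V) {v s t : E} (hv : v ∈ V)
    (hs : s ∈ V) (ht : t ∈ V) (hsv : s ≠ v) (htv : t ≠ v) (hst : s ≠ t) :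
    t - v ∉ Submodule.span ℝ {s - v} := by
  intro h
  obtain ⟨c, hc⟩ := Submodule.mem_span_singleton.1 h
  have hval : ∀ f : StrongDual ℝ E, c * (f s - f v) = f t - f v := fun f => by
    have := congrArg f hc
    simpa using this
  obtain ⟨lv, hlv⟩ := hV.exists_dual_lt hv
  obtain ⟨ls, hls⟩ := hV.exists_dual_lt hs
  obtain ⟨lt, hlt⟩ := hV.exists_dual_lt ht
  have h1 := hval lv
  have h2 := hval ls
  have h3 := hval lt
  have a1 := hlv s hs hsv
  have a2 := hlv t ht htv
  have b1 := hls v hv hsv.symm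
  have b2 := hls t ht hst.symm
  have c1 := hlt v hv htv.symm
  have c2 := hlt s hs hst
  have hc0 : 0 < c := by
    by_contra! h0
    nlinarith
  have hc1 : c < 1 := by
    by_contra! h0
    nlinarith
  nlinarith

/-- Tilting a hyperplane that touches only `v` yields a larger face through `v` on which `m` is at
least `m v`. A smallest such face is an edge: a third point would not be collinear with the others,
so a further tilt inside the face would shrink it. -/
theorem IsVertexSet.exists_adj_le [FiniteDimensional ℝ E] {V : Set E} (hfin : V.Finite)
    (hV : IsVertexSet V) {v x : E} (hv : v ∈ V) (hx : x ∈ V) (hxv : x ≠ v)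
    {m : StrongDual ℝ E} (hm : m v ≤ m x) : ∃ w, Adj V v w ∧ m v ≤ m w := by
  obtain ⟨l, hl⟩ := hV.exists_dual_lt hv
  have hle : ∀ y ∈ V, l y ≤ l v := fun y hy => by
    by_cases h : y = v
    · rw [h]
    · exact (hl y hy h).le
  have hiff : ∀ A ⊆ V, v ∈ A → ∀ y, y ∈ ({v} : Set E) ↔ y ∈ A ∧ l y = l v :=
    fun A hA hvA y => ⟨by rintro rfl; exact ⟨hvA, rfl⟩, fun h => by
      by_contra hy
      exact (hl y (hA h.1) hy).ne h.2⟩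
  let good : Set (Set E) :=
    {A | IsFaceSet V A ∧ v ∈ A ∧ A ≠ {v} ∧ ∀ s ∈ A, m v ≤ m s}
  have hgood : good.Nonempty := by
    obtain ⟨r, hr, s, hs, hsv, hsr⟩ := exists_tilt (k := m) (d := m v) hfin hle
      (hiff V subset_rfl hv) (by rintro x rfl; rfl) (fun h => hxv (by rw [← h] at hx; exact hx))
    refine ⟨{y ∈ V | (m + r • l) y = m v + r * l v}, ⟨⟨s, hs, hsr⟩, _, _, hr, fun _ => Iff.rfl⟩,
      ⟨hv, by simp⟩, fun h => hsv (h ▸ ⟨hs, hsr⟩), fun y hy => ?_⟩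
    have hr0 : 0 ≤ r := by
      have h1 := hr x hx
      have h2 := hl x hx hxv
      simp only [add_apply, smul_apply, smul_eq_mul] at h1
      by_contra! h0
      nlinarith [mul_pos_of_neg_of_neg h0 (sub_neg.2 h2)]
    have h1 := hy.2
    have h2 := hle y hy.1
    simp only [add_apply, smul_apply, smul_eq_mul] at h1
    nlinarith [mul_nonneg hr0 (sub_nonneg.2 h2)]
  have hgfin : good.Finite := hfin.finite_subsets.subset fun A hA => hA.1.subset
  obtain ⟨A, ⟨hA, hvA, hne, hmA⟩, hmin⟩ := Set.exists_min_image good Set.ncard hgfin hgood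
  obtain ⟨s, hs, hsv⟩ : ∃ s ∈ A, s ≠ v := by
    by_contra! h
    exact hne (Set.eq_singleton_iff_unique_mem.2 ⟨hvA, h⟩)
  suffices h : ∀ t ∈ A, t ≠ v → t = s by
    have : A = {v, s} := by
      ext y
      constructor
      · intro hy
        by_cases hyv : y = v
        · exact Or.inl hyv
        · exact Or.inr (h y hy hyv)
      · rintro (rfl | rfl)
        exacts [hvA, hs]
    exact ⟨s, ⟨hsv.symm, this ▸ hA⟩, hmA s hs⟩
  intro t ht htv
  by_contra hst
  obtain ⟨k, hk, hspan⟩ := Submodule.exists_le_ker_of_notMem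
    (hV.notMem_span hv (hA.subset hs) (hA.subset ht) hsv htv (Ne.symm hst))
  have hks : k s = k v := by
    have := hspan (Submodule.mem_span_singleton_self (s - v))
    simpa [sub_eq_zero] using this
  have hkt : k t ≠ k v := by simpa [sub_eq_zero] using hk
  obtain ⟨r, hr, hB, hvB, hBA⟩ := IsFaceSet.exists_larger_proper
    (k := LinearMap.toContinuousLinearMap k) (d := k v) (hfin.subset hA.subset)
    (Set.singleton_nonempty v) (fun y hy => hle y (hA.subset hy)) (hiff A hA.subset hvA)
    (by rintro x rfl; rfl) ⟨s, hs, hsv, hks⟩ ⟨t, ht, htv, hkt⟩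
  have h1 := hmin _ ⟨hA.trans hfin hB, hvB.1 rfl, hvB.ne', fun y hy => hmA y (hBA.1 hy)⟩
  have h2 := Set.ncard_lt_ncard hBA (hfin.subset hA.subset)
  omega

theorem IsVertexSet.exists_adj_lt [FiniteDimensional ℝ E] {V : Set E} (hfin : V.Finite)
    (hV : IsVertexSet V) {v x : E} (hv : v ∈ V) (hx : x ∈ V)
    {m : StrongDual ℝ E} (hm : m v < m x) : ∃ w, Adj V v w ∧ m v < m w := by
  obtain ⟨l, hl⟩ := hV.exists_dual_lt hv
  have hxv : x ≠ v := by
    rintro rfl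
    exact lt_irrefl _ hm
  have hlx := hl x hx hxv
  have hpos : 0 < (m x - m v) / (l v - l x) := div_pos (by linarith) (by linarith)
  have hmul : (m x - m v) / (l v - l x) * (l v - l x) = m x - m v :=
    div_mul_cancel₀ _ (by linarith)
  set ε := (m x - m v) / (l v - l x)
  -- This `ε` makes `v` and `x` level for `m + ε • l`; as `l` peaks at `v`, the weak inequality for
  -- the sum becomes strict for `m`.
  obtain ⟨w, hw, hmw⟩ := hV.exists_adj_le hfin hv hx hxv (m := m + ε • l) (by
    simp only [add_apply, smul_apply, smul_eq_mul]
    linarith)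
  refine ⟨w, hw, ?_⟩
  have := hl w hw.right_mem hw.1.symm
  simp only [add_apply, smul_apply, smul_eq_mul] at hmw
  nlinarith [mul_pos hpos (sub_pos.2 this)]

theorem IsVertexSet.le_of_forall_adj_le [FiniteDimensional ℝ E] {V : Set E} (hfin : V.Finite)
    (hV : IsVertexSet V) {v : E} (hv : v ∈ V) {m : StrongDual ℝ E}
    (h : ∀ w, Adj V v w → m w ≤ m v) {x : E} (hx : x ∈ V) : m x ≤ m v := by
  by_contra! hlt
  obtain ⟨w, hw, hmw⟩ := hV.exists_adj_lt hfin hv hx hlt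
  exact (h w hw).not_gt hmw

theorem IsVertexSet.lt_of_forall_adj_lt [FiniteDimensional ℝ E] {V : Set E} (hfin : V.Finite)
    (hV : IsVertexSet V) {v : E} (hv : v ∈ V) {m : StrongDual ℝ E}
    (h : ∀ w, Adj V v w → m w < m v) {x : E} (hx : x ∈ V) (hxv : x ≠ v) : m x < m v := by
  by_contra! hlt
  obtain ⟨w, hw, hmw⟩ := hV.exists_adj_le hfin hv hx hxv hlt
  exact (h w hw).not_ge hmw

theorem exists_coeff_of_mem_openSegment {v w x : E} (hx : x ∈ openSegment ℝ v w) :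
    ∃ a b : ℝ, 0 < a ∧ 0 < b ∧ a + b = 1 ∧ ∀ m : StrongDual ℝ E, m x = a * m v + b * m w := by
  obtain ⟨a, b, ha, hb, hab, rfl⟩ := hx
  exact ⟨a, b, ha, hb, hab, fun m => by simp⟩

theorem lt_of_mem_openSegment {v w x : E} (hx : x ∈ openSegment ℝ v w) {m : StrongDual ℝ E}
    {μ : ℝ} (h : m x ≤ μ) (hv : μ < m v) : m w < μ := by
  obtain ⟨a, b, ha, hb, hab, hm⟩ := exists_coeff_of_mem_openSegment hx
  rw [hm] at h
  obtain rfl : a = 1 - b := by linarith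
  by_contra! hw
  nlinarith

theorem le_of_mem_openSegment {v w x : E} (hx : x ∈ openSegment ℝ v w) {m : StrongDual ℝ E}
    {μ : ℝ} (h : m x ≤ μ) (hv : μ ≤ m v) : m w ≤ μ := by
  obtain ⟨a, b, ha, hb, hab, hm⟩ := exists_coeff_of_mem_openSegment hx
  rw [hm] at h
  obtain rfl : a = 1 - b := by linarith
  by_contra! hw
  nlinarith

theorem eq_of_mem_openSegment {v w x : E} (hx : x ∈ openSegment ℝ v w) {m : StrongDual ℝ E}
    {μ : ℝ} (h : m x = μ) (hv : m v ≤ μ) (hw : m w ≤ μ) : m v = μ ∧ m w = μ := by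
  obtain ⟨a, b, ha, hb, hab, hm⟩ := exists_coeff_of_mem_openSegment hx
  rw [hm] at h
  obtain rfl : a = 1 - b := by linarith
  constructor <;> apply le_antisymm (by assumption) <;> by_contra! h' <;> nlinarith

theorem apply_eq_of_mem_openSegment {v w x : E} (hx : x ∈ openSegment ℝ v w) {m : StrongDual ℝ E}
    {μ : ℝ} (hv : m v = μ) (hw : m w = μ) : m x = μ := by
  obtain ⟨a, b, ha, hb, hab, hm⟩ := exists_coeff_of_mem_openSegment hx
  rw [hm, hv, hw, ← add_mul, hab, one_mul]

theorem apply_le_of_mem_openSegment {v w x : E} (hx : x ∈ openSegment ℝ v w)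
    {m : StrongDual ℝ E} {μ : ℝ} (hv : m v ≤ μ) (hw : m w ≤ μ) : m x ≤ μ := by
  obtain ⟨a, b, ha, hb, hab, hm⟩ := exists_coeff_of_mem_openSegment hx
  rw [hm]
  obtain rfl : a = 1 - b := by linarith
  nlinarith

theorem apply_lt_of_mem_openSegment {v w x : E} (hx : x ∈ openSegment ℝ v w)
    {m : StrongDual ℝ E} {μ : ℝ} (hv : m v < μ) (hw : m w ≤ μ) : m x < μ := by
  obtain ⟨a, b, ha, hb, hab, hm⟩ := exists_coeff_of_mem_openSegment hx
  rw [hm]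
  obtain rfl : a = 1 - b := by linarith
  nlinarith

/-- A halfspace that contains a point of the relative interior of every edge misses at most one
vertex, and the other vertices lie in its interior. -/
theorem IsVertexSet.lt_of_lt [FiniteDimensional ℝ E] {V : Set E} (hfin : V.Finite)
    (hV : IsVertexSet V) {m : StrongDual ℝ E} {μ : ℝ}
    (h : ∀ v w, Adj V v w → ∃ x ∈ openSegment ℝ v w, m x ≤ μ) {v u : E} (hv : v ∈ V)
    (hmv : μ < m v) (hu : u ∈ V) (huv : u ≠ v) : m u < μ := by
  by_contra! hmu
  -- An edge whose one end is at or above `μ` has its other end at or below `μ`. So both `u` and `v`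
  -- would be local maxima, and `v` a strict one.
  have h1 : m v ≤ m u := hV.le_of_forall_adj_le hfin hu (fun w hw => by
    obtain ⟨x, hx, hxm⟩ := h u w hw
    exact (le_of_mem_openSegment hx hxm hmu).trans hmu) hv
  have h2 : m u < m v := hV.lt_of_forall_adj_lt hfin hv (fun w hw => by
    obtain ⟨x, hx, hxm⟩ := h v w hw
    exact (lt_of_mem_openSegment hx hxm hmv).trans hmv) hu huv
  exact h1.not_gt h2

end Edges

/-! ### Truncations: cut points and the two kinds of faces -/

section Truncation

variable {E : Type*} [NormedAddCommGroup E] [NormedSpace ℝ E]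

/-- Every `v ∈ V` is cut off by the halfspace `l v ≤ c v`, whose boundary meets each edge
`[v, w]` in the point `p v w`. -/
structure IsTruncation (V : Set E) (l : E → StrongDual ℝ E) (c : E → ℝ) (p : E → E → E) :
    Prop where
  finite : V.Finite
  vertex : IsVertexSet V
  mem : ∀ {v w}, Adj V v w → p v w ∈ openSegment ℝ v w
  comm : ∀ v w, p v w = p w v
  lt_self : ∀ {v}, v ∈ V → c v < l v v
  lt : ∀ {v u}, v ∈ V → u ∈ V → u ≠ v → l v u < c v
  eq : ∀ {v w}, Adj V v w → l v (p v w) = c v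

/-- The cut points on the edges with both ends in `F`. -/
def innerPoints (V : Set E) (p : E → E → E) (F : Set E) : Set E :=
  {x | ∃ v ∈ F, ∃ w ∈ F, Adj V v w ∧ x = p v w}

/-- The cut points on the edges from `v` to elements of `F`. -/
def starPoints (V : Set E) (p : E → E → E) (v : E) (F : Set E) : Set E :=
  {x | ∃ w ∈ F, Adj V v w ∧ x = p v w}

variable {V : Set E} {l : E → StrongDual ℝ E} {c : E → ℝ} {p : E → E → E}

theorem starPoints_subset_innerPoints {F : Set E} {v : E} (hv : v ∈ F) :
    starPoints V p v F ⊆ innerPoints V p F := by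
  rintro x ⟨w, hw, h, rfl⟩
  exact ⟨v, hv, w, hw, h, rfl⟩

theorem innerPoints_mono {F G : Set E} (h : F ⊆ G) : innerPoints V p F ⊆ innerPoints V p G := by
  rintro x ⟨v, hv, w, hw, h', rfl⟩
  exact ⟨v, h hv, w, h hw, h', rfl⟩

namespace IsTruncation

theorem innerPoints_subset_convexHull (h : IsTruncation V l c p) (F : Set E) :
    innerPoints V p F ⊆ convexHull ℝ F := by
  rintro x ⟨v, hv, w, hw, ha, rfl⟩
  exact (convex_convexHull ℝ F).openSegment_subset (subset_convexHull ℝ F hv)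
    (subset_convexHull ℝ F hw) (h.mem ha)

theorem innerPoints_finite (h : IsTruncation V l c p) (F : Set E) :
    (innerPoints V p F).Finite := by
  refine ((h.finite.prod h.finite).image fun q => p q.1 q.2).subset ?_
  rintro x ⟨v, hv, w, hw, ha, rfl⟩
  exact ⟨(v, w), ⟨ha.left_mem, ha.right_mem⟩, rfl⟩

/-- If the hyperplane `m = μ` separates `v` from all cut points, then it can be rotated about
its intersection with the hyperplane truncating `v` to a hyperplane that supports `V` at `v`. -/
theorem exists_supporting [FiniteDimensional ℝ E] (h : IsTruncation V l c p)
    {m : StrongDual ℝ E} {μ : ℝ} {v : E} (hv : v ∈ V) (hmv : μ < m v)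
    (hm : ∀ w, Adj V v w → m (p v w) ≤ μ) :
    ∃ t ≤ 0, (m + t • l v) v = μ + t * c v ∧ ∀ x ∈ V, (m + t • l v) x ≤ μ + t * c v := by
  have h0 := h.lt_self hv
  have hmul : -(m v - μ) / (l v v - c v) * (l v v - c v) = -(m v - μ) :=
    div_mul_cancel₀ _ (by linarith)
  have ht : -(m v - μ) / (l v v - c v) ≤ 0 :=
    div_nonpos_of_nonpos_of_nonneg (by linarith) (by linarith)
  -- The value of `t` that puts `v` on the hyperplane `m + t • l v = μ + t * c v`.
  set t := -(m v - μ) / (l v v - c v)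
  have hval : (m + t • l v) v = μ + t * c v := by
    simp only [add_apply, smul_apply, smul_eq_mul]
    linarith
  refine ⟨t, ht, hval, fun x hx => ?_⟩
  rw [← hval]
  refine h.vertex.le_of_forall_adj_le h.finite hv (fun w hw => ?_) hx
  rw [hval]
  -- At the cut point `l v = c v`, so the bound there is the old one. As `v` attains equality, the
  -- far end of the edge satisfies the bound too.
  refine le_of_mem_openSegment (h.mem hw) ?_ hval.ge
  have := hm w hw
  simp only [add_apply, smul_apply, smul_eq_mul, h.eq hw]
  linarith

theorem lt_of_lt [FiniteDimensional ℝ E] (h : IsTruncation V l c p)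
    {m : StrongDual ℝ E} {μ : ℝ} (hm : ∀ x ∈ innerPoints V p V, m x ≤ μ) {v u : E} (hv : v ∈ V)
    (hmv : μ < m v) (hu : u ∈ V) (huv : u ≠ v) : m u < μ :=
  h.vertex.lt_of_lt h.finite (fun v w ha =>
    ⟨p v w, h.mem ha, hm _ ⟨v, ha.left_mem, w, ha.right_mem, ha, rfl⟩⟩) hv hmv hu huv

/-- A point `q` of the truncation outside the hull is separated from it by some `m = μ`, with a
vertex `v` beyond. The rotated hyperplane supports `V`, and `t ≤ 0` with `l v q ≤ c v` then yields
`m q ≤ μ`. -/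
theorem inter_eq_convexHull [FiniteDimensional ℝ E] (h : IsTruncation V l c p) :
    convexHull ℝ V ∩ {x | ∀ v ∈ V, l v x ≤ c v} = convexHull ℝ (innerPoints V p V) := by
  apply Set.Subset.antisymm
  · rintro q ⟨hqV, hq⟩
    by_contra hqT
    obtain ⟨m, μ, hmT, hmq⟩ := geometric_hahn_banach_closed_point (convex_convexHull ℝ _)
      ((h.innerPoints_finite V).isClosed_convexHull ℝ) hqT
    have hm : ∀ x ∈ innerPoints V p V, m x ≤ μ := fun x hx =>
      (hmT x (subset_convexHull ℝ _ hx)).le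
    obtain ⟨v, hv, hmv⟩ : ∃ v ∈ V, μ < m v := by
      by_contra! hall
      have : convexHull ℝ V ⊆ {x | m x ≤ μ} :=
        convexHull_min hall (convex_halfSpace_le m.isLinear μ)
      exact (this hqV).not_gt hmq
    obtain ⟨t, ht, -, hsup⟩ := h.exists_supporting hv hmv
      fun w hw => hm _ ⟨v, hv, w, hw.right_mem, hw, rfl⟩
    have : convexHull ℝ V ⊆ {x | (m + t • l v) x ≤ μ + t * c v} :=
      convexHull_min hsup (convex_halfSpace_le (m + t • l v).isLinear _)
    have h1 : (m + t • l v) q ≤ μ + t * c v := this hqV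
    have h2 := hq v hv
    simp only [add_apply, smul_apply, smul_eq_mul] at h1
    nlinarith [mul_nonneg (neg_nonneg.2 ht) (sub_nonneg.2 h2)]
  · apply convexHull_min
    · intro x hx
      refine ⟨h.innerPoints_subset_convexHull V hx, fun u hu => ?_⟩
      obtain ⟨v, hv, w, hw, ha, rfl⟩ := hx
      by_cases hvu : v = u
      · subst hvu
        exact (h.eq ha).le
      by_cases hwu : w = u
      · subst hwu
        rw [h.comm]
        exact (h.eq ha.symm).le
      exact apply_le_of_mem_openSegment (h.mem ha) (h.lt hu hv hvu).le (h.lt hu hw hwu).le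
    · refine (convex_convexHull ℝ V).inter ?_
      have : {x | ∀ v ∈ V, l v x ≤ c v} = ⋂ v ∈ V, {x | l v x ≤ c v} := by
        ext x
        simp
      rw [this]
      exact convex_iInter₂ fun v _ => convex_halfSpace_le (l v).isLinear _

/-- The faces of a deep vertex truncation. -/
theorem face_cases [FiniteDimensional ℝ E] (h : IsTruncation V l c p) {B : Set E}
    (hB : IsFaceSet (innerPoints V p V) B) :
    ∃ F, IsFaceSet V F ∧ (B = innerPoints V p F ∨ ∃ v ∈ F, B = starPoints V p v F) := by
  obtain ⟨⟨b, hb⟩, m, μ, hm, hiff⟩ := hB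
  by_cases hle : ∀ v ∈ V, m v ≤ μ
  · refine ⟨{v ∈ V | m v = μ}, ⟨?_, m, μ, hle, fun _ => Iff.rfl⟩, Or.inl ?_⟩
    · obtain ⟨⟨v, hv, w, hw, ha, rfl⟩, hbm⟩ := (hiff b).1 hb
      exact ⟨v, hv, (eq_of_mem_openSegment (h.mem ha) hbm (hle v hv) (hle w hw)).1⟩
    · ext x
      rw [hiff]
      constructor
      · rintro ⟨⟨v, hv, w, hw, ha, rfl⟩, hx⟩
        obtain ⟨h1, h2⟩ := eq_of_mem_openSegment (h.mem ha) hx (hle v hv) (hle w hw)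
        exact ⟨v, ⟨hv, h1⟩, w, ⟨hw, h2⟩, ha, rfl⟩
      · rintro ⟨v, ⟨hv, h1⟩, w, ⟨hw, h2⟩, ha, rfl⟩
        exact ⟨⟨v, hv, w, hw, ha, rfl⟩, apply_eq_of_mem_openSegment (h.mem ha) h1 h2⟩
  · push Not at hle
    obtain ⟨v, hv, hmv⟩ := hle
    obtain ⟨t, ht, htv, hsup⟩ := h.exists_supporting hv hmv
      fun w hw => hm _ ⟨v, hv, w, hw.right_mem, hw, rfl⟩
    have hstar : ∀ w, Adj V v w → (m (p v w) = μ ↔ (m + t • l v) w = μ + t * c v) := by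
      intro w ha
      have : m (p v w) = μ ↔ (m + t • l v) (p v w) = μ + t * c v := by
        simp [h.eq ha]
      rw [this]
      exact ⟨fun h' => (eq_of_mem_openSegment (h.mem ha) h' htv.le (hsup w ha.right_mem)).2,
        fun h' => apply_eq_of_mem_openSegment (h.mem ha) htv h'⟩
    refine ⟨{x ∈ V | (m + t • l v) x = μ + t * c v},
      ⟨⟨v, hv, htv⟩, _, _, hsup, fun _ => Iff.rfl⟩, Or.inr ⟨v, ⟨hv, htv⟩, ?_⟩⟩
    ext x
    rw [hiff]
    constructor
    · rintro ⟨⟨u, hu, w, hw, ha, rfl⟩, hx⟩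
      by_cases huv : u = v
      · subst huv
        exact ⟨w, ⟨hw, (hstar w ha).1 hx⟩, ha, rfl⟩
      by_cases hwv : w = v
      · subst hwv
        rw [h.comm] at hx ⊢
        exact ⟨u, ⟨hu, (hstar u ha.symm).1 hx⟩, ha.symm, rfl⟩
      -- Only `v` lies beyond the hyperplane, so an edge avoiding `v` has both ends strictly below
      -- it.
      exact absurd hx (apply_lt_of_mem_openSegment (h.mem ha) (h.lt_of_lt hm hv hmv hu huv)
        (h.lt_of_lt hm hv hmv hw hwv).le).ne
    · rintro ⟨w, ⟨hw, hw'⟩, ha, rfl⟩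
      exact ⟨⟨v, hv, w, hw, ha, rfl⟩, (hstar w ha).2 hw'⟩

theorem mem_of_mem_innerPoints (h : IsTruncation V l c p) {F : Set E} (hF : IsFaceSet V F)
    {v w : E} (ha : Adj V v w) (hx : p v w ∈ innerPoints V p F) : v ∈ F ∧ w ∈ F := by
  obtain ⟨-, m, μ, hm, hiff⟩ := hF
  obtain ⟨a, haF, b, hbF, hab, heq⟩ := hx
  have hval : m (p v w) = μ := by
    rw [heq]
    exact apply_eq_of_mem_openSegment (h.mem hab) ((hiff a).1 haF).2 ((hiff b).1 hbF).2
  obtain ⟨h1, h2⟩ := eq_of_mem_openSegment (h.mem ha) hval (hm v ha.left_mem) (hm w ha.right_mem)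
  exact ⟨(hiff v).2 ⟨ha.left_mem, h1⟩, (hiff w).2 ⟨ha.right_mem, h2⟩⟩

theorem isFaceSet_innerPoints (h : IsTruncation V l c p) {F : Set E} (hF : IsFaceSet V F)
    (hne : (innerPoints V p F).Nonempty) :
    IsFaceSet (innerPoints V p V) (innerPoints V p F) := by
  obtain ⟨-, m, μ, hm, hiff⟩ := hF
  refine ⟨hne, m, μ, ?_, fun x => ⟨?_, ?_⟩⟩
  · rintro x ⟨v, hv, w, hw, ha, rfl⟩
    exact apply_le_of_mem_openSegment (h.mem ha) (hm v hv) (hm w hw)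
  · rintro ⟨v, hv, w, hw, ha, rfl⟩
    exact ⟨⟨v, ha.left_mem, w, ha.right_mem, ha, rfl⟩,
      apply_eq_of_mem_openSegment (h.mem ha) ((hiff v).1 hv).2 ((hiff w).1 hw).2⟩
  · rintro ⟨⟨v, hv, w, hw, ha, rfl⟩, hx⟩
    obtain ⟨h1, h2⟩ := eq_of_mem_openSegment (h.mem ha) hx (hm v hv) (hm w hw)
    exact ⟨v, (hiff v).2 ⟨hv, h1⟩, w, (hiff w).2 ⟨hw, h2⟩, ha, rfl⟩

theorem apply_lt_of_ne (h : IsTruncation V l c p) {u v w : E} (hu : u ∈ V) (ha : Adj V v w)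
    (hv : v ≠ u) (hw : w ≠ u) : l u (p v w) < c u :=
  apply_lt_of_mem_openSegment (h.mem ha) (h.lt hu ha.left_mem hv) (h.lt hu ha.right_mem hw).le

theorem eq_or_eq_of_mem_starPoints (h : IsTruncation V l c p) {u v w : E} {F : Set E}
    (hu : u ∈ V) (ha : Adj V v w) (hx : p v w ∈ starPoints V p u F) : v = u ∨ w = u := by
  obtain ⟨b, hb, hub, heq⟩ := hx
  by_contra! hne
  have := h.apply_lt_of_ne hu ha hne.1 hne.2
  rw [heq, h.eq hub] at this
  exact lt_irrefl _ this

theorem isFaceSet_starPoints (h : IsTruncation V l c p) {v : E} (hv : v ∈ V)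
    (hne : (starPoints V p v V).Nonempty) :
    IsFaceSet (innerPoints V p V) (starPoints V p v V) := by
  refine ⟨hne, l v, c v, ?_, fun x => ⟨?_, ?_⟩⟩
  · rintro x ⟨a, ha, b, hb, hab, rfl⟩
    by_cases hav : a = v
    · subst hav
      exact (h.eq hab).le
    by_cases hbv : b = v
    · subst hbv
      rw [h.comm]
      exact (h.eq hab.symm).le
    exact (h.apply_lt_of_ne hv hab hav hbv).le
  · rintro ⟨w, hw, ha, rfl⟩
    exact ⟨⟨v, hv, w, hw, ha, rfl⟩, h.eq ha⟩
  · rintro ⟨⟨a, ha, b, hb, hab, rfl⟩, hx⟩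
    by_cases hav : a = v
    · subst hav
      exact ⟨b, hb, hab, rfl⟩
    by_cases hbv : b = v
    · subst hbv
      exact ⟨a, ha, hab.symm, h.comm _ _⟩
    exact absurd hx (h.apply_lt_of_ne hv hab hav hbv).ne

theorem ncard_starPoints_add_one_le {F : Set E} {v : E} (hfin : F.Finite) (hv : v ∈ F) :
    (starPoints V p v F).ncard + 1 ≤ F.ncard := by
  rw [← Set.ncard_sdiff_singleton_add_one hv hfin, Nat.add_le_add_iff_right]
  refine (Set.ncard_le_ncard ?_ ((hfin.sdiff).image (p v))).trans (Set.ncard_image_le hfin.sdiff)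
  rintro x ⟨w, hw, ha, rfl⟩
  exact ⟨w, ⟨hw, ha.1.symm⟩, rfl⟩

theorem innerPoints_subset_triple (h : IsTruncation V l c p) {F : Set E} {a b d : E}
    (hF : F ⊆ {a, b, d}) :
    innerPoints V p F ⊆ {p a b, p a d, p b d} := by
  rintro x ⟨v, hv, w, hw, ha, rfl⟩
  rcases hF hv with rfl | rfl | rfl <;> rcases hF hw with rfl | rfl | rfl <;>
    first
      | exact absurd rfl ha.1
      | simp [h.comm]

theorem innerPoints_subset_singleton (h : IsTruncation V l c p) {F : Set E} {a b : E}
    (hF : F ⊆ {a, b}) :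
    innerPoints V p F ⊆ {p a b} := by
  rintro x ⟨v, hv, w, hw, ha, rfl⟩
  rcases hF hv with rfl | rfl <;> rcases hF hw with rfl | rfl <;>
    first
      | exact absurd rfl ha.1
      | simp [h.comm]

theorem ncard_innerPoints_le_three (h : IsTruncation V l c p) {F : Set E}
    (hF : F.ncard = 3) :
    (innerPoints V p F).ncard ≤ 3 := by
  obtain ⟨a, b, d, -, -, -, rfl⟩ := Set.ncard_eq_three.1 hF
  refine (Set.ncard_le_ncard (h.innerPoints_subset_triple subset_rfl)).trans ?_
  exact (Set.ncard_insert_le _ _).trans (Nat.succ_le_succ ((Set.ncard_insert_le _ _).trans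
    (by simp)))

/-- Triangles are what is needed: let a functional equal `μ` at every cut point. If it exceeds `μ`
at one corner it is below `μ` at the other two, hence also at the cut point between them. Applied to
`m` and `-m`, this makes `m` constant on `F`. -/
theorem dim_innerPoints [FiniteDimensional ℝ E] (h : IsTruncation V l c p) {F : Set E}
    (hF : ∀ v ∈ F, ∃ a ∈ F, ∃ b ∈ F, Adj V v a ∧ Adj V v b ∧ Adj V a b) :
    dim (innerPoints V p F) = dim F := by
  have : vectorSpan ℝ (innerPoints V p F) = vectorSpan ℝ F := by
    apply le_antisymm
    · rw [← vectorSpan_convexHull F]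
      exact vectorSpan_mono ℝ (h.innerPoints_subset_convexHull F)
    · apply vectorSpan_le_iff_forall_dual
      intro m hm x₀ hx₀ y₀ hy₀
      obtain ⟨a₀, ha₀, -, -, h₀, -⟩ := hF x₀ hx₀
      have hconst : ∀ v ∈ F, ∀ w ∈ F, Adj V v w → m (p v w) = m (p x₀ a₀) := by
        intro v hv w hw ha
        have := hm _ (vsub_mem_vectorSpan ℝ (s := innerPoints V p F) (p₁ := p v w)
          (p₂ := p x₀ a₀) ⟨v, hv, w, hw, ha, rfl⟩ ⟨x₀, hx₀, a₀, ha₀, h₀, rfl⟩)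
        simpa [sub_eq_zero] using this
      have key : ∀ v ∈ F, ∀ f : StrongDual ℝ E, ∀ μ : ℝ,
          (∀ v ∈ F, ∀ w ∈ F, Adj V v w → f (p v w) = μ) → f v ≤ μ := by
        intro v hv f μ hf
        obtain ⟨a, haF, b, hbF, hva, hvb, hab⟩ := hF v hv
        by_contra! hlt
        have h1 := lt_of_mem_openSegment (h.mem hva) (hf v hv a haF hva).le hlt
        have h2 := lt_of_mem_openSegment (h.mem hvb) (hf v hv b hbF hvb).le hlt
        exact (apply_lt_of_mem_openSegment (h.mem hab) h1 h2.le).ne (hf a haF b hbF hab)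
      have hall : ∀ v ∈ F, m v = m (p x₀ a₀) := fun v hv => by
        apply le_antisymm (key v hv m _ hconst)
        have := key v hv (-m) (-m (p x₀ a₀)) fun v hv w hw ha => by simp [hconst v hv w hw ha]
        simpa using this
      rw [hall x₀ hx₀, hall y₀ hy₀]
  rw [dim, this, dim]

/-- The direction `q - v` joins `v` to the star points; a functional constant on all of these is
constant on the neighbours of `v` in `F`, and `hF` extends this to `F`. -/
theorem dim_le_dim_starPoints [FiniteDimensional ℝ E] (h : IsTruncation V l c p) {F : Set E}
    {v : E} (hne : (starPoints V p v F).Nonempty)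
    (hF : ∀ m : StrongDual ℝ E, (∀ w ∈ F, Adj V v w → m w = m v) → ∀ x ∈ F, m x = m v) :
    dim F ≤ dim (starPoints V p v F) + 1 := by
  obtain ⟨q, hq⟩ := hne
  have hle : vectorSpan ℝ F ≤
      vectorSpan ℝ (starPoints V p v F) ⊔ Submodule.span ℝ {q - v} := by
    apply vectorSpan_le_iff_forall_dual
    intro m hm
    have hqv : m q = m v := by
      have := hm _ (Submodule.mem_sup_right (Submodule.mem_span_singleton_self _))
      simpa [sub_eq_zero] using this
    have hw : ∀ w ∈ F, Adj V v w → m w = m v := by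
      intro w hw ha
      have h1 := hm _ (Submodule.mem_sup_left
        (vsub_mem_vectorSpan ℝ (s := starPoints V p v F) (p₁ := p v w) ⟨w, hw, ha, rfl⟩ hq))
      have h2 : m (p v w) = m v := by
        rw [← hqv]
        simpa [sub_eq_zero] using h1
      obtain ⟨a, b, ha, hb, hab, hm⟩ := exists_coeff_of_mem_openSegment (h.mem ha)
      rw [hm] at h2
      obtain rfl : a = 1 - b := by linarith
      have : b * (m w - m v) = 0 := by linarith
      rcases mul_eq_zero.1 this with h3 | h3
      · exact absurd h3 hb.ne'
      · linarith
    exact fun x hx y hy => (hF m hw x hx).trans (hF m hw y hy).symm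
  have h1 := Submodule.finrank_mono hle
  have h2 := Submodule.finrank_add_le_finrank_add_finrank (vectorSpan ℝ (starPoints V p v F))
    (Submodule.span ℝ {q - v})
  have h3 := finrank_span_le_card (R := ℝ) ({q - v} : Set E)
  simp only [Set.toFinset_singleton, Finset.card_singleton] at h3
  unfold dim
  omega

theorem starPoints_nonempty [FiniteDimensional ℝ E] (h : IsTruncation V l c p) {v : E}
    (hv : v ∈ V) (hd : 0 < dim V) : (starPoints V p v V).Nonempty := by
  obtain ⟨x, hx, hxv⟩ : ∃ x ∈ V, x ≠ v := by
    by_contra! hall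
    rw [Set.eq_singleton_iff_unique_mem.2 ⟨hv, hall⟩, dim_singleton] at hd
    exact lt_irrefl _ hd
  obtain ⟨w, hw, -⟩ := h.vertex.exists_adj_le h.finite hv hx hxv (m := 0) (by simp)
  exact ⟨p v w, w, hw.right_mem, hw, rfl⟩

theorem dim_starPoints_self [FiniteDimensional ℝ E] (h : IsTruncation V l c p) {v : E}
    (hv : v ∈ V) (hd : 0 < dim V) : dim (starPoints V p v V) + 1 = dim V := by
  have hne := h.starPoints_nonempty hv hd
  apply le_antisymm
  · refine Submodule.finrank_lt_finrank_of_lt (lt_of_le_of_ne ?_ fun heq => ?_)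
    · rw [← vectorSpan_convexHull V]
      exact vectorSpan_mono ℝ
        ((starPoints_subset_innerPoints hv).trans (h.innerPoints_subset_convexHull V))
    · have h1 : vectorSpan ℝ (starPoints V p v V) ≤ LinearMap.ker (l v).toLinearMap := by
        refine vectorSpan_le_ker_iff.2 ?_
        rintro _ ⟨a, ha, hva, rfl⟩ _ ⟨b, hb, hvb, rfl⟩
        exact (h.eq hva).trans (h.eq hvb).symm
      rw [heq, vectorSpan_le_ker_iff] at h1
      obtain ⟨q, w, hw, ha, rfl⟩ := hne
      have h2 : l v w = l v v := h1 w hw v hv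
      have h3 := h.lt hv hw ha.1.symm
      have h4 := h.lt_self hv
      linarith
  · refine h.dim_le_dim_starPoints hne fun m hm x hx => ?_
    apply le_antisymm
    · exact h.vertex.le_of_forall_adj_le h.finite hv (fun w hw => (hm w hw.right_mem hw).le) hx
    · have := h.vertex.le_of_forall_adj_le (m := -m) h.finite hv
        (fun w hw => by simp [hm w hw.right_mem hw]) hx
      simpa using this

end IsTruncation

end Truncation

/-! ### From point sets to convex hulls; simplices and segments -/

section ConvexHull

variable {E : Type*} [NormedAddCommGroup E] [NormedSpace ℝ E]

/-- The open halfspace `l < c` together with the hull of the points at level `c` is convex and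
contains `V`. -/
theorem mem_convexHull_of_apply_eq {V : Set E} {l : StrongDual ℝ E} {c : ℝ}
    (hl : ∀ x ∈ V, l x ≤ c) {x : E} (hx : x ∈ convexHull ℝ V) (hxc : l x = c) :
    x ∈ convexHull ℝ {y ∈ V | l y = c} := by
  have hA : ∀ y ∈ convexHull ℝ {y ∈ V | l y = c}, l y ≤ c := fun y hy =>
    convexHull_min (fun z hz => hl z hz.1) (convex_halfSpace_le l.isLinear c) hy
  have hconv : Convex ℝ ({y | l y < c} ∪ convexHull ℝ {y ∈ V | l y = c}) := by
    rw [convex_iff_forall_pos]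
    have key : ∀ y z : E, ∀ a b : ℝ, 0 < a → 0 < b → a + b = 1 → l y < c → l z ≤ c →
        l (a • y + b • z) < c := by
      intro y z a b ha hb hab hy hz
      obtain rfl : a = 1 - b := by linarith
      simp only [map_add, map_smul, smul_eq_mul]
      nlinarith
    rintro y (hy | hy) z (hz | hz) a b ha hb hab
    · exact Or.inl (key y z a b ha hb hab hy (le_of_lt hz))
    · exact Or.inl (key y z a b ha hb hab hy (hA z hz))
    · rw [add_comm]
      exact Or.inl (key z y b a hb ha (by linarith) hz (hA y hy))
    · exact Or.inr (convex_convexHull ℝ _ hy hz ha.le hb.le hab)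
  have hsub : V ⊆ {y | l y < c} ∪ convexHull ℝ {y ∈ V | l y = c} := fun y hy => by
    rcases (hl y hy).lt_or_eq with h | h
    · exact Or.inl h
    · exact Or.inr (subset_convexHull ℝ _ ⟨hy, h⟩)
  rcases convexHull_min hsub hconv hx with h | h
  · exact absurd hxc (ne_of_lt h)
  · exact h

theorem isFace_convexHull_iff {V : Set E} {k : ℕ} {F : Set E} :
    IsFace (convexHull ℝ V) k F ↔ ∃ A, IsFaceSet V A ∧ F = convexHull ℝ A ∧ dim A = k := by
  constructor
  · rintro ⟨hne, hexp, hdim⟩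
    obtain ⟨l, hl⟩ := hexp hne
    obtain ⟨x₀, hx₀⟩ := hne
    have hx₀' := hx₀
    rw [hl] at hx₀'
    obtain ⟨hx₀P, hmax⟩ := hx₀'
    have hV : ∀ x ∈ V, l x ≤ l x₀ := fun x hx => hmax x (subset_convexHull ℝ V hx)
    have hF : F = convexHull ℝ {y ∈ V | l y = l x₀} := by
      apply Set.Subset.antisymm
      · intro x hx
        rw [hl] at hx
        exact mem_convexHull_of_apply_eq hV hx.1 (le_antisymm (hmax x hx.1) (hx.2 x₀ hx₀P))
      · intro x hx
        have h1 : l x = l x₀ :=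
          convexHull_min (fun y hy => hy.2) (convex_hyperplane l.isLinear (l x₀)) hx
        rw [hl]
        exact ⟨convexHull_mono (fun y hy => hy.1) hx, fun y hy => h1 ▸ hmax y hy⟩
    refine ⟨{y ∈ V | l y = l x₀}, ⟨?_, l, l x₀, hV, fun _ => Iff.rfl⟩, hF, ?_⟩
    · rw [← convexHull_nonempty_iff (𝕜 := ℝ), ← hF]
      exact ⟨x₀, hx₀⟩
    · rw [← dim_convexHull, ← hF, hdim]
  · rintro ⟨A, ⟨⟨a, ha⟩, l, c, hl, hA⟩, rfl, hdim⟩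
    refine ⟨⟨a, subset_convexHull ℝ A ha⟩, fun _ => ⟨l, ?_⟩, by rw [dim_convexHull, hdim]⟩
    have hle : ∀ y ∈ convexHull ℝ V, l y ≤ c := fun y hy =>
      convexHull_min hl (convex_halfSpace_le l.isLinear c) hy
    have hAe : A = {y ∈ V | l y = c} := Set.ext hA
    ext x
    constructor
    · intro hx
      have h1 : l x = c :=
        convexHull_min (fun y hy => ((hA y).1 hy).2) (convex_hyperplane l.isLinear c) hx
      exact ⟨convexHull_mono (fun y hy => ((hA y).1 hy).1) hx, fun y hy => h1 ▸ hle y hy⟩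
    · rintro ⟨hx, hmax⟩
      rw [hAe]
      refine mem_convexHull_of_apply_eq hl hx (le_antisymm (hle x hx) ?_)
      have := hmax a (subset_convexHull ℝ V ((hA a).1 ha).1)
      rwa [((hA a).1 ha).2] at this

theorem IsFaceSet.mem_of_mem_convexHull {V A : Set E} (hA : IsFaceSet V A) {x : E} (hx : x ∈ V)
    (hxA : x ∈ convexHull ℝ A) : x ∈ A := by
  obtain ⟨-, l, c, -, h⟩ := hA
  have h1 : l x = c :=
    convexHull_min (fun y hy => ((h y).1 hy).2) (convex_hyperplane l.isLinear c) hxA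
  exact (h x).2 ⟨hx, h1⟩

theorem IsFaceSet.convexHull_subset_iff {V A B : Set E} (hA : A ⊆ V) (hB : IsFaceSet V B) :
    convexHull ℝ A ⊆ convexHull ℝ B ↔ A ⊆ B :=
  ⟨fun h _ hx => hB.mem_of_mem_convexHull (hA hx) (h (subset_convexHull ℝ A hx)),
    fun h => convexHull_mono h⟩

theorem isFaceSet_singleton_of_isFace {V : Set E} {v : E}
    (h : IsFace (convexHull ℝ V) 0 {v}) : IsFaceSet V {v} := by
  obtain ⟨A, hA, heq, -⟩ := isFace_convexHull_iff.1 h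
  have hsub : A ⊆ {v} := by
    rw [heq]
    exact subset_convexHull ℝ A
  rwa [← (Set.Nonempty.subset_singleton_iff hA.1).1 hsub]

theorem vertices_convexHull_subset {V : Set E} : vertices (convexHull ℝ V) ⊆ V :=
  fun _ hv => (isFaceSet_singleton_of_isFace hv).subset rfl

/-- The hull of the extreme points is dense by Krein–Milman; for finite `S`, an extreme point is
strictly separated from the hull of the rest, hence exposed. -/
theorem convexHull_vertices [FiniteDimensional ℝ E] {S : Set E} (hS : S.Finite) :
    convexHull ℝ (vertices (convexHull ℝ S)) = convexHull ℝ S := by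
  have hfin : (vertices (convexHull ℝ S)).Finite := hS.subset vertices_convexHull_subset
  apply Set.Subset.antisymm
  · exact convexHull_mono vertices_convexHull_subset
  · refine (closure_convexHull_extremePoints (hS.isCompact_convexHull (𝕜 := ℝ))
      (convex_convexHull ℝ S)).ge.trans ?_
    refine closure_minimal (convexHull_mono fun v hv => ?_) (hfin.isClosed_convexHull ℝ)
    have hvS : v ∈ S := extremePoints_convexHull_subset hv
    have hv' := (((convex_convexHull ℝ S).mem_extremePoints_iff_mem_sdiff_convexHull_sdiff).1 hv).2
    have hv'' : v ∉ convexHull ℝ (S \ {v}) := fun h =>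
      hv' (convexHull_mono (Set.sdiff_subset_sdiff_left (subset_convexHull ℝ S)) h)
    obtain ⟨f, u, hf, hu⟩ := geometric_hahn_banach_closed_point (convex_convexHull ℝ _)
      ((hS.sdiff (t := {v})).isClosed_convexHull ℝ) hv''
    have hlt : ∀ x ∈ S, x ≠ v → f x < f v := fun x hx hxv =>
      (hf x (subset_convexHull ℝ _ ⟨hx, hxv⟩)).trans hu
    refine isFace_convexHull_iff.2 ⟨{v}, ⟨Set.singleton_nonempty v, f, f v, fun x hx => ?_,
      fun x => ⟨?_, fun h => ?_⟩⟩, (convexHull_singleton v).symm, dim_singleton v⟩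
    · by_cases hxv : x = v
      · rw [hxv]
      · exact (hlt x hx hxv).le
    · rintro rfl
      exact ⟨hvS, rfl⟩
    · by_contra hxv
      exact (hlt x h.1 hxv).ne h.2

theorem dim_add_one_le_ncard [FiniteDimensional ℝ E] {A : Set E} (hA : A.Finite)
    (hne : A.Nonempty) : dim A + 1 ≤ A.ncard := by
  have := hA.fintype
  have := hne.to_subtype
  have h := finrank_vectorSpan_range_add_one_le ℝ ((↑) : A → E)
  rwa [Subtype.range_coe, ← Nat.card_eq_fintype_card, Nat.card_coe_set_eq] at h

theorem dim_add_one_of_affineIndependent [FiniteDimensional ℝ E] {A : Set E} (hA : A.Finite)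
    (hne : A.Nonempty) (h : AffineIndependent ℝ ((↑) : A → E)) : dim A + 1 = A.ncard := by
  have := hA.fintype
  have hpos : 0 < A.ncard := (Set.ncard_pos hA).2 hne
  have hc : Fintype.card A = (A.ncard - 1) + 1 := by
    rw [← Nat.card_eq_fintype_card, Nat.card_coe_set_eq]
    omega
  have := h.finrank_vectorSpan hc
  rw [Subtype.range_coe] at this
  unfold dim
  omega

theorem isSimplex_convexHull [FiniteDimensional ℝ E] {A : Set E} {k : ℕ} (hA : A.Finite)
    (hne : A.Nonempty) (hcard : A.ncard ≤ k + 1) (hd : dim A = k) :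
    IsSimplex k (convexHull ℝ A) := by
  have := hA.fintype
  have h1 := dim_add_one_le_ncard hA hne
  have hc : Fintype.card A = k + 1 := by
    rw [← Nat.card_eq_fintype_card, Nat.card_coe_set_eq]
    omega
  let e := (Fintype.equivFinOfCardEq hc).symm
  have hr : Set.range (fun i => (e i : E)) = A := by
    have : (fun i => (e i : E)) = ((↑) : A → E) ∘ e := rfl
    rw [this, e.surjective.range_comp, Subtype.range_coe]
  refine ⟨fun i => (e i : E), ?_, by rw [hr]⟩
  rw [affineIndependent_iff_finrank_vectorSpan_eq ℝ _ (Fintype.card_fin (k + 1)), hr]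
  exact hd

theorem affineIndependent_of_isSimplex {B : Set E} (hB : IsVertexSet B) {k : ℕ}
    (h : IsSimplex k (convexHull ℝ B)) : AffineIndependent ℝ ((↑) : B → E) := by
  obtain ⟨q, hq, heq⟩ := h
  refine hq.range.mono fun b hb => ?_
  have h1 : IsFace (convexHull ℝ B) 0 {b} :=
    isFace_convexHull_iff.2 ⟨{b}, hB b hb, (convexHull_singleton b).symm, dim_singleton b⟩
  rw [heq] at h1
  exact (isFaceSet_singleton_of_isFace h1).subset rfl

/-- Points are removed one at a time: deleting `x` lowers the dimension, so some functional is
constant on the rest and differs at `x`. -/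
theorem isFaceSet_of_affineIndependent [FiniteDimensional ℝ E] {B C : Set E} (hB : B.Finite)
    (h : AffineIndependent ℝ ((↑) : B → E)) (hC : C ⊆ B) (hne : C.Nonempty) :
    IsFaceSet B C := by
  induction hn : B.ncard using Nat.strong_induction_on generalizing B with
  | _ n ih =>
    by_cases hCB : C = B
    · rw [hCB]
      exact isFaceSet_self (hCB ▸ hne)
    · obtain ⟨x, hx, hxC⟩ := Set.exists_of_ssubset (lt_of_le_of_ne hC hCB)
      have hCx : C ⊆ B \ {x} := fun y hy => ⟨hC hy, fun h => hxC (h ▸ hy)⟩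
      have hne' : (B \ {x}).Nonempty := hne.mono hCx
      have hfin : (B \ {x}).Finite := hB.sdiff
      have hcard : (B \ {x}).ncard + 1 = B.ncard := Set.ncard_sdiff_singleton_add_one hx hB
      have hind : AffineIndependent ℝ ((↑) : ↥(B \ {x}) → E) := h.mono Set.sdiff_subset
      refine IsFaceSet.trans hB ?_ (ih _ (by omega) hfin hind hCx rfl)
      have h1 := dim_add_one_of_affineIndependent hB ⟨x, hx⟩ h
      have h2 := dim_add_one_of_affineIndependent hfin hne' hind
      have hnle : ¬ vectorSpan ℝ B ≤ vectorSpan ℝ (B \ {x}) := fun hle => by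
        have := Submodule.finrank_mono hle
        unfold dim at h1 h2
        omega
      obtain ⟨m, hm, y, hy, z, hz, hyz⟩ := exists_dual_of_not_vectorSpan_le hnle
      obtain ⟨b, hb⟩ := hne'
      have hmb : ∀ y ∈ B \ {x}, m y = m b := fun y hy => by
        have := hm _ (vsub_mem_vectorSpan ℝ hy hb)
        simpa [sub_eq_zero] using this
      have hmx : m x ≠ m b := fun hmx => by
        have hall : ∀ y ∈ B, m y = m b := fun y hy => by
          by_cases hyx : y = x
          · rw [hyx, hmx]
          · exact hmb y ⟨hy, hyx⟩
        exact hyz ((hall y hy).trans (hall z hz).symm)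
      have key : ∀ f : StrongDual ℝ E, (∀ y ∈ B \ {x}, f y = f b) → f x < f b →
          IsFaceSet B (B \ {x}) := by
        intro f hf hfx
        refine ⟨⟨b, hb⟩, f, f b, fun y hy => ?_, fun y => ⟨fun hy => ⟨hy.1, hf y hy⟩, ?_⟩⟩
        · by_cases hyx : y = x
          · rw [hyx]
            exact hfx.le
          · exact (hf y ⟨hy, hyx⟩).le
        · rintro ⟨hy, hyb⟩
          refine ⟨hy, ?_⟩
          rintro rfl
          exact hfx.ne hyb
      rcases lt_or_gt_of_ne hmx with hlt | hgt
      · exact key m hmb hlt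
      · exact key (-m) (fun y hy => by simp [hmb y hy]) (by simpa using hgt)

/-- Otherwise the line could be followed slightly beyond `v` while staying in the segment. -/
theorem left_notMem_intrinsicInterior_segment {v w : E} (hvw : v ≠ w) :
    v ∉ intrinsicInterior ℝ (segment ℝ v w) := by
  intro hv
  obtain ⟨y, hy, hyv⟩ := mem_intrinsicInterior.1 hv
  have hw : w ∈ affineSpan ℝ (segment ℝ v w) :=
    subset_affineSpan ℝ _ (right_mem_segment ℝ v w)
  have hv' : v ∈ affineSpan ℝ (segment ℝ v w) :=
    subset_affineSpan ℝ _ (left_mem_segment ℝ v w)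
  let g : ℝ → affineSpan ℝ (segment ℝ v w) :=
    fun t => ⟨AffineMap.lineMap v w t, AffineMap.lineMap_mem t hv' hw⟩
  have hg : Continuous g := by
    refine Continuous.subtype_mk ?_ _
    exact AffineMap.lineMap_continuous
  have hg0 : g 0 = y := by
    apply Subtype.ext
    simp [g, hyv]
  have hnear : ∀ᶠ t in nhds (0 : ℝ), (g t : E) ∈ segment ℝ v w := by
    have h1 := mem_interior_iff_mem_nhds.1 hy
    rw [← hg0] at h1
    exact hg.continuousAt.eventually h1
  obtain ⟨ε, hε, hball⟩ := Metric.eventually_nhds_iff.1 hnear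
  have hmem : AffineMap.lineMap v w (-(ε / 2)) ∈ segment ℝ v w := hball (by
    rw [Real.dist_eq, sub_zero, abs_neg, abs_of_pos (by linarith)]
    linarith)
  rw [segment_eq_image_lineMap] at hmem
  obtain ⟨s, ⟨hs, -⟩, heq⟩ := hmem
  have := AffineMap.lineMap_injective ℝ hvw heq
  linarith

theorem mem_openSegment_of_mem_intrinsicInterior {v w x : E} (hvw : v ≠ w)
    (hx : x ∈ intrinsicInterior ℝ (segment ℝ v w)) : x ∈ openSegment ℝ v w := by
  refine mem_openSegment_of_ne_left_right ?_ ?_ (intrinsicInterior_subset hx)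
  · rintro rfl
    exact left_notMem_intrinsicInterior_segment hvw hx
  · rintro rfl
    rw [segment_symm] at hx
    exact left_notMem_intrinsicInterior_segment hvw.symm hx

end ConvexHull

/-! ### Simplicial 4-polytopes -/

section SimplicialFour

variable {E : Type*} [NormedAddCommGroup E] [NormedSpace ℝ E] [FiniteDimensional ℝ E]

/-- `V` is the vertex set of a simplicial `4`-polytope. -/
structure IsSimplicialVertexSet (V : Set E) : Prop where
  finite : V.Finite
  vertex : IsVertexSet V
  dim_eq : dim V = 4
  indep : ∀ B, IsFaceSet V B → dim B = 3 → AffineIndependent ℝ ((↑) : B → E)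

namespace IsSimplicialVertexSet

variable {V F : Set E}

theorem affineIndependent (hV : IsSimplicialVertexSet V) (hF : IsFaceSet V F) (hne : F ≠ V) :
    AffineIndependent ℝ ((↑) : F → E) := by
  obtain ⟨B, hB, hFB, hd⟩ := hF.exists_facet hV.finite hne
  rw [hV.dim_eq] at hd
  exact (hV.indep B hB (by omega)).mono hFB

theorem dim_add_one (hV : IsSimplicialVertexSet V) (hF : IsFaceSet V F) (hne : F ≠ V) : dim F + 1 = F.ncard :=
  dim_add_one_of_affineIndependent (hV.finite.subset hF.subset) hF.1 (hV.affineIndependent hF hne)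

theorem ncard_le (hV : IsSimplicialVertexSet V) (hF : IsFaceSet V F) (hne : F ≠ V) : F.ncard ≤ 4 := by
  have h1 := hV.dim_add_one hF hne
  have h2 := hF.dim_lt (lt_of_le_of_ne hF.subset hne) subset_rfl
  rw [hV.dim_eq] at h2
  omega

theorem adj (hV : IsSimplicialVertexSet V) (hF : IsFaceSet V F) (hne : F ≠ V) {v w : E}
    (hv : v ∈ F) (hw : w ∈ F) (hvw : v ≠ w) : Adj V v w :=
  ⟨hvw, hF.trans hV.finite (isFaceSet_of_affineIndependent (hV.finite.subset hF.subset)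
    (hV.affineIndependent hF hne) (Set.insert_subset hv (Set.singleton_subset_iff.2 hw))
    ⟨v, by simp⟩)⟩

theorem exists_triangle (hV : IsSimplicialVertexSet V) (hF : IsFaceSet V F) (hne : F ≠ V)
    (hcard : 3 ≤ F.ncard) {v : E} (hv : v ∈ F) : ∃ a ∈ F, ∃ b ∈ F, Adj V v a ∧ Adj V v b ∧ Adj V a b := by
  have hfin := hV.finite.subset hF.subset
  have h1 := Set.ncard_sdiff_singleton_add_one hv hfin
  obtain ⟨a, b, ha, hb, hab⟩ := (Set.one_lt_ncard_iff (hfin.sdiff (t := {v}))).1 (by omega)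
  exact ⟨a, ha.1, b, hb.1, hV.adj hF hne hv ha.1 (Ne.symm ha.2),
    hV.adj hF hne hv hb.1 (Ne.symm hb.2), hV.adj hF hne ha.1 hb.1 hab⟩

theorem exists_triangle_self (hV : IsSimplicialVertexSet V) {v : E} (hv : v ∈ V) :
    ∃ a ∈ V, ∃ b ∈ V, Adj V v a ∧ Adj V v b ∧ Adj V a b := by
  have hne : {v} ≠ V := fun h => by
    have := hV.dim_eq
    rw [← h, dim_singleton] at this
    omega
  obtain ⟨B, hB, hvB, hd⟩ := (hV.vertex v hv).exists_facet hV.finite hne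
  have hBV : B ≠ V := fun h => by
    rw [h] at hd
    omega
  have h1 := hV.dim_add_one hB hBV
  rw [hV.dim_eq] at hd
  obtain ⟨a, ha, b, hb, h⟩ := hV.exists_triangle hB hBV (by omega) (hvB rfl)
  exact ⟨a, hB.subset ha, b, hB.subset hb, h⟩

theorem exists_triangle_of_dim (hV : IsSimplicialVertexSet V) (hF : IsFaceSet V F)
    (hd : 2 ≤ dim F) {v : E} (hv : v ∈ F) :
    ∃ a ∈ F, ∃ b ∈ F, Adj V v a ∧ Adj V v b ∧ Adj V a b := by
  by_cases hne : F = V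
  · subst hne
    exact hV.exists_triangle_self hv
  · have := hV.dim_add_one hF hne
    exact hV.exists_triangle hF hne (by omega) hv

end IsSimplicialVertexSet

/-! ### Dimensions and incidences of faces of the truncation -/

namespace IsTruncation

variable {V F : Set E} {l : E → StrongDual ℝ E} {c : E → ℝ} {p : E → E → E}

theorem dim_innerPoints_of_ncard_le_two (h : IsTruncation V l c p) (hF : F.Nonempty)
    (hfin : F.Finite) (hcard : F.ncard ≤ 2) : dim (innerPoints V p F) = 0 := by
  have hpos := (Set.ncard_pos hfin).2 hF
  obtain ⟨a, b, hab⟩ : ∃ a b, F ⊆ {a, b} := by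
    have : F.ncard = 1 ∨ F.ncard = 2 := by omega
    rcases this with h1 | h2
    · obtain ⟨a, rfl⟩ := Set.ncard_eq_one.1 h1
      exact ⟨a, a, by simp⟩
    · obtain ⟨a, b, -, rfl⟩ := Set.ncard_eq_two.1 h2
      exact ⟨a, b, subset_rfl⟩
  have := dim_mono (h.innerPoints_subset_singleton hab)
  rw [dim_singleton] at this
  omega

/-- Vertices and edges of `P` contribute at most one cut point, so dimension 1 never occurs for
faces of this kind. -/
theorem dim_innerPoints_of_pos (h : IsTruncation V l c p) (hV : IsSimplicialVertexSet V)
    (hF : IsFaceSet V F) (hpos : 0 < dim (innerPoints V p F)) :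
    dim (innerPoints V p F) = dim F ∧ 2 ≤ dim F := by
  have hd : 2 ≤ dim F := by
    by_contra! hd
    have hne : F ≠ V := by
      rintro rfl
      rw [hV.dim_eq] at hd
      omega
    have := hV.dim_add_one hF hne
    rw [h.dim_innerPoints_of_ncard_le_two hF.1 (hV.finite.subset hF.subset) (by omega)] at hpos
    exact lt_irrefl _ hpos
  exact ⟨h.dim_innerPoints fun v hv => hV.exists_triangle_of_dim hF hd hv, hd⟩

/-- For proper `F` the upper bound is a count: a simplex has `dim F` vertices besides `v`, hence at
most that many star points. -/
theorem dim_starPoints (h : IsTruncation V l c p) (hV : IsSimplicialVertexSet V)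
    (hF : IsFaceSet V F) {v : E} (hv : v ∈ F) (hne : (starPoints V p v F).Nonempty) :
    dim (starPoints V p v F) + 1 = dim F := by
  by_cases hFV : F = V
  · subst hFV
    exact h.dim_starPoints_self hv (by rw [hV.dim_eq]; omega)
  · have hfin := hV.finite.subset hF.subset
    have h1 : dim F ≤ dim (starPoints V p v F) + 1 := by
      refine h.dim_le_dim_starPoints hne fun m hm x hx => ?_
      by_cases hxv : x = v
      · rw [hxv]
      · exact hm x hx (hV.adj hF hFV hv hx (Ne.symm hxv))
    have h2 := hV.dim_add_one hF hFV
    have h3 := ncard_starPoints_add_one_le (V := V) (p := p) hfin hv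
    have h4 := dim_add_one_le_ncard
      ((h.innerPoints_finite F).subset (starPoints_subset_innerPoints hv)) hne
    omega

/-- The truncation is `2`-simplicial. -/
theorem ncard_le_three_of_dim_eq_two (h : IsTruncation V l c p) (hV : IsSimplicialVertexSet V)
    {B : Set E} (hB : IsFaceSet (innerPoints V p V) B) (hd : dim B = 2) : B.ncard ≤ 3 := by
  have hneV : ∀ {F : Set E}, dim F < 4 → F ≠ V := by
    rintro F hF rfl
    rw [hV.dim_eq] at hF
    omega
  obtain ⟨F, hF, rfl | ⟨v, hv, rfl⟩⟩ := h.face_cases hB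
  · have h1 := h.dim_innerPoints_of_pos hV hF (by omega)
    have h2 := hV.dim_add_one hF (hneV (by omega))
    exact h.ncard_innerPoints_le_three (by omega)
  · have h1 := h.dim_starPoints hV hF hv hB.1
    have h2 := hV.dim_add_one hF (hneV (by omega))
    have h3 := ncard_starPoints_add_one_le (V := V) (p := p) (hV.finite.subset hF.subset) hv
    omega

theorem facet_iff (h : IsTruncation V l c p) (hV : IsSimplicialVertexSet V) {B : Set E} :
    IsFaceSet (innerPoints V p V) B ∧ dim B = 3 ↔
      (∃ F, IsFaceSet V F ∧ dim F = 3 ∧ B = innerPoints V p F) ∨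
        ∃ v ∈ V, B = starPoints V p v V := by
  constructor
  · rintro ⟨hB, hd⟩
    obtain ⟨F, hF, rfl | ⟨v, hv, rfl⟩⟩ := h.face_cases hB
    · have h1 := h.dim_innerPoints_of_pos hV hF (by omega)
      exact Or.inl ⟨F, hF, by omega, rfl⟩
    · have h1 := h.dim_starPoints hV hF hv hB.1
      by_cases hFV : F = V
      · subst hFV
        exact Or.inr ⟨v, hv, rfl⟩
      -- A star of dimension 3 needs `dim F = 4`, but a proper face has at most four vertices.
      · have h2 := hV.dim_add_one hF hFV
        have h3 := hV.ncard_le hF hFV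
        omega
  · rintro (⟨F, hF, hd, rfl⟩ | ⟨v, hv, rfl⟩)
    · have h1 := fun v (hv : v ∈ F) => hV.exists_triangle_of_dim hF (by omega) hv
      obtain ⟨x, hx⟩ := hF.1
      obtain ⟨a, ha, -, -, hxa, -⟩ := h1 x hx
      exact ⟨h.isFaceSet_innerPoints hF ⟨_, x, hx, a, ha, hxa, rfl⟩,
        (h.dim_innerPoints h1).trans hd⟩
    · have hpos : 0 < dim V := by rw [hV.dim_eq]; omega
      have h1 := h.dim_starPoints_self hv hpos
      rw [hV.dim_eq] at h1
      exact ⟨h.isFaceSet_starPoints hv (h.starPoints_nonempty hv hpos), by omega⟩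

theorem subset_of_innerPoints_subset (h : IsTruncation V l c p) (hV : IsSimplicialVertexSet V)
    {G : Set E} (hF : IsFaceSet V F) (hG : IsFaceSet V G) (hd : 2 ≤ dim F)
    (hsub : innerPoints V p F ⊆ innerPoints V p G) : F ⊆ G := by
  intro x hx
  obtain ⟨a, ha, -, -, hxa, -⟩ := hV.exists_triangle_of_dim hF hd hx
  exact (h.mem_of_mem_innerPoints hG hxa (hsub ⟨x, hx, a, ha, hxa, rfl⟩)).1

/-- The truncation is `2`-simple. -/
theorem exists_three_facets (h : IsTruncation V l c p) (hV : IsSimplicialVertexSet V)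
    {B : Set E} (hB : IsFaceSet (innerPoints V p V) B) (hd : dim B = 1) :
    ∃ B₁ B₂ B₃, B₁ ≠ B₂ ∧ B₁ ≠ B₃ ∧ B₂ ≠ B₃ ∧
      ∀ C, ((IsFaceSet (innerPoints V p V) C ∧ dim C = 3) ∧ B ⊆ C) ↔
        C = B₁ ∨ C = B₂ ∨ C = B₃ := by
  obtain ⟨F, hF, rfl | ⟨v, hv, rfl⟩⟩ := h.face_cases hB
  · have h1 := h.dim_innerPoints_of_pos hV hF (by omega)
    omega
  have hdF := h.dim_starPoints hV hF hv hB.1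
  have hFV : F ≠ V := by
    rintro rfl
    rw [hV.dim_eq] at hdF
    omega
  obtain ⟨F₁, F₂, hne, hfac⟩ := hF.exists_two_facets hV.finite (by rw [hV.dim_eq]; omega)
  rw [hV.dim_eq] at hfac
  obtain ⟨hF₁, hd₁, hFF₁⟩ := (hfac F₁).2 (Or.inl rfl)
  obtain ⟨hF₂, hd₂, hFF₂⟩ := (hfac F₂).2 (Or.inr rfl)
  obtain ⟨a, ha, b, hb, hva, hvb, hab⟩ := hV.exists_triangle_of_dim hF (by omega) hv
  -- The cut point on the side `ab` of the triangle opposite `v` distinguishes the facets.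
  have hstar : ∀ G, F ⊆ G → starPoints V p v V ≠ innerPoints V p G := by
    intro G hFG heq
    have h1 : p a b ∈ starPoints V p v V := by
      rw [heq]
      exact ⟨a, hFG ha, b, hFG hb, hab, rfl⟩
    rcases h.eq_or_eq_of_mem_starPoints (hF.subset hv) hab h1 with rfl | rfl
    · exact hva.1 rfl
    · exact hvb.1 rfl
  refine ⟨starPoints V p v V, innerPoints V p F₁, innerPoints V p F₂, hstar _ hFF₁,
    hstar _ hFF₂, fun heq => hne ?_, fun C => ⟨?_, ?_⟩⟩
  · exact Set.Subset.antisymm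
      (h.subset_of_innerPoints_subset hV hF₁ hF₂ (by omega) heq.subset)
      (h.subset_of_innerPoints_subset hV hF₂ hF₁ (by omega) heq.superset)
  · rintro ⟨hC, hBC⟩
    rcases (h.facet_iff hV).1 hC with ⟨G, hG, hdG, rfl⟩ | ⟨u, hu, rfl⟩
    · right
      have hFG : F ⊆ G := fun x hx => by
        by_cases hxv : x = v
        · subst hxv
          exact (h.mem_of_mem_innerPoints hG hva (hBC ⟨a, ha, hva, rfl⟩)).1
        · have hvx := hV.adj hF hFV hv hx (Ne.symm hxv)
          exact (h.mem_of_mem_innerPoints hG hvx (hBC ⟨x, hx, hvx, rfl⟩)).2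
      rcases (hfac G).1 ⟨hG, by omega, hFG⟩ with rfl | rfl
      · exact Or.inl rfl
      · exact Or.inr rfl
    · left
      -- The star of `u` contains the cut points of both `va` and `vb`, whose only common end is
      -- `v`.
      rcases h.eq_or_eq_of_mem_starPoints hu hva (hBC ⟨a, ha, hva, rfl⟩) with rfl | rfl
      · rfl
      · rcases h.eq_or_eq_of_mem_starPoints hu hvb (hBC ⟨b, hb, hvb, rfl⟩) with rfl | rfl
        · rfl
        · exact absurd rfl hab.1
  · have hsub : ∀ G, F ⊆ G → starPoints V p v F ⊆ innerPoints V p G := fun G hFG =>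
      (starPoints_subset_innerPoints hv).trans (innerPoints_mono hFG)
    rintro (rfl | rfl | rfl)
    · refine ⟨(h.facet_iff hV).2 (Or.inr ⟨v, hF.subset hv, rfl⟩), ?_⟩
      rintro x ⟨w, hw, hvw, rfl⟩
      exact ⟨w, hF.subset hw, hvw, rfl⟩
    · exact ⟨(h.facet_iff hV).2 (Or.inl ⟨F₁, hF₁, by omega, rfl⟩), hsub _ hFF₁⟩
    · exact ⟨(h.facet_iff hV).2 (Or.inl ⟨F₂, hF₂, by omega, rfl⟩), hsub _ hFF₂⟩

theorem isPolytope (h : IsTruncation V l c p) (hV : IsSimplicialVertexSet V) :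
    IsPolytope 4 (convexHull ℝ (innerPoints V p V)) := by
  have hd : dim (innerPoints V p V) = 4 := by
    rw [h.dim_innerPoints fun v hv => hV.exists_triangle_self hv, hV.dim_eq]
  refine ⟨⟨_, h.innerPoints_finite V, ?_, rfl⟩, by rw [dim_convexHull, hd]⟩
  rw [Set.nonempty_iff_ne_empty]
  intro hempty
  rw [hempty, dim, vectorSpan_empty, finrank_bot] at hd
  omega

theorem isHSimple (h : IsTruncation V l c p) (hV : IsSimplicialVertexSet V) :
    IsHSimple 4 2 (convexHull ℝ (innerPoints V p V)) := by
  intro j k G hj hk hG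
  obtain rfl : j = 1 := by omega
  obtain rfl : k = 3 := by omega
  obtain ⟨B, hB, rfl, hd⟩ := isFace_convexHull_iff.1 hG
  obtain ⟨B₁, B₂, B₃, h12, h13, h23, hiff⟩ := h.exists_three_facets hV hB hd
  have hfacets : {F | IsFace (convexHull ℝ (innerPoints V p V)) 3 F ∧ convexHull ℝ B ⊆ F} =
      convexHull ℝ '' {B₁, B₂, B₃} := by
    ext C
    constructor
    · rintro ⟨hC, hBC⟩
      obtain ⟨A, hA, rfl, hdA⟩ := isFace_convexHull_iff.1 hC
      exact ⟨A, (hiff A).1 ⟨⟨hA, hdA⟩, (hA.convexHull_subset_iff hB.subset).1 hBC⟩, rfl⟩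
    · rintro ⟨A, hA, rfl⟩
      obtain ⟨⟨hA, hdA⟩, hBA⟩ := (hiff A).2 hA
      exact ⟨isFace_convexHull_iff.2 ⟨A, hA, rfl, hdA⟩, convexHull_mono hBA⟩
  have hinj : Set.InjOn (convexHull ℝ : Set E → Set E) {B₁, B₂, B₃} := by
    intro A hA A' hA' heq
    have h1 := ((hiff A).2 hA).1.1
    have h2 := ((hiff A').2 hA').1.1
    exact Set.Subset.antisymm ((h2.convexHull_subset_iff h1.subset).1 heq.subset)
      ((h1.convexHull_subset_iff h2.subset).1 heq.superset)
  rw [hfacets, hinj.ncard_image]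
  exact Set.ncard_eq_three.2 ⟨B₁, B₂, B₃, h12, h13, h23, rfl⟩

theorem isKSimplicial (h : IsTruncation V l c p) (hV : IsSimplicialVertexSet V) :
    IsKSimplicial 2 (convexHull ℝ (innerPoints V p V)) := by
  intro G hG
  obtain ⟨B, hB, rfl, hd⟩ := isFace_convexHull_iff.1 hG
  exact isSimplex_convexHull ((h.innerPoints_finite V).subset hB.subset) hB.1
    (h.ncard_le_three_of_dim_eq_two hV hB hd) hd

end IsTruncation

/-! ### Reduction of the geometric statement to vertex sets -/

theorem IsSimplicialPolytope.exists_vertexSet {P : Set E} (hP : IsSimplicialPolytope 4 P) :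
    IsSimplicialVertexSet (vertices P) ∧ P = convexHull ℝ (vertices P) := by
  obtain ⟨⟨⟨S, hS, -, rfl⟩, hd⟩, hsimp⟩ := hP
  have heq := convexHull_vertices hS
  set V := vertices (convexHull ℝ S) with hVdef
  have hvert : IsVertexSet V := fun v hv => by
    have : IsFace (convexHull ℝ S) 0 {v} := hv
    rw [← heq] at this
    exact isFaceSet_singleton_of_isFace this
  refine ⟨⟨hS.subset vertices_convexHull_subset, hvert, ?_, fun B hB hdB => ?_⟩, heq.symm⟩
  · rw [← dim_convexHull, heq, hd]
  · refine affineIndependent_of_isSimplex (fun b hb =>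
      (hvert b (hB.subset hb)).mono (Set.singleton_subset_iff.2 hb) hB.subset) (k := 3) ?_
    refine hsimp 3 rfl _ ?_
    rw [← heq]
    exact isFace_convexHull_iff.2 ⟨B, hB, rfl, hdB⟩

theorem IsDeepVertexTruncation.exists_isTruncation {P Q : Set E}
    (hV : IsSimplicialVertexSet (vertices P)) (hP : P = convexHull ℝ (vertices P))
    (hQ : IsDeepVertexTruncation P Q) :
    ∃ (l : E → StrongDual ℝ E) (c : E → ℝ) (p : E → E → E),
      IsTruncation (vertices P) l c p ∧
        Q = convexHull ℝ (innerPoints (vertices P) p (vertices P)) := by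
  obtain ⟨H, hH, hQ, hedge⟩ := hQ
  set V := vertices P with hVdef
  have hHs : ∀ v ∈ V, ∃ (l : StrongDual ℝ E) (c : ℝ), H v = {x | l x ≤ c} ∧ c < l v := by
    intro v hv
    obtain ⟨⟨l, c, -, hl⟩, hvH⟩ := hH v hv
    rw [hl] at hvH
    exact ⟨l, c, hl, not_le.1 hvH⟩
  choose! l c hl hlv using hHs
  have hQmem : ∀ x, x ∈ Q ↔ x ∈ P ∧ ∀ v ∈ V, l v x ≤ c v := by
    intro x
    rw [hQ, Set.mem_inter_iff, Set.mem_iInter₂]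
    refine and_congr_right fun _ => forall₂_congr fun v hv => ?_
    rw [hl v hv, Set.mem_ofPred_eq]
  choose! q hqint hqQ using hedge
  have hface : ∀ {v w}, Adj V v w → IsFace P 1 (convexHull ℝ {v, w}) := by
    intro v w ha
    rw [hP]
    refine isFace_convexHull_iff.2 ⟨_, ha.2, rfl, ?_⟩
    have h1 := dim_add_one_le_ncard (A := {v, w}) (by simp) (by simp)
    rw [Set.ncard_pair ha.1] at h1
    have h2 := (hV.vertex v ha.left_mem).dim_lt (B := {v, w})
      ⟨by simp, fun hsub => ha.1 (hsub (Set.mem_insert_of_mem _ rfl)).symm⟩ ha.2.subset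
    rw [dim_singleton] at h2
    omega
  -- Choosing the cut point from the edge as a set makes `p` symmetric.
  let p : E → E → E := fun v w => q (convexHull ℝ {v, w})
  have hpseg : ∀ {v w}, Adj V v w → p v w ∈ openSegment ℝ v w := fun {v w} ha => by
    have := hqint _ (hface ha)
    rw [convexHull_pair] at this
    exact mem_openSegment_of_mem_intrinsicInterior ha.1 (by simpa only [p, convexHull_pair])
  have hpQ : ∀ {v w}, Adj V v w → p v w ∈ Q := fun {v w} ha => by
    have : q (convexHull ℝ {v, w}) ∈ Q ∩ convexHull ℝ {v, w} := by
      rw [hqQ _ (hface ha)]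
      rfl
    exact this.1
  have hlt : ∀ {v u}, v ∈ V → u ∈ V → u ≠ v → l v u < c v := fun {v u} hv hu huv =>
    hV.vertex.lt_of_lt hV.finite (fun a b ha =>
      ⟨p a b, hpseg ha, ((hQmem _).1 (hpQ ha)).2 v hv⟩) hv (hlv v hv) hu huv
  have heq : ∀ {v w}, Adj V v w → l v (p v w) = c v := by
    intro v w ha
    have hv := ha.left_mem
    have hp := (hQmem _).1 (hpQ ha)
    refine le_antisymm (hp.2 v hv) ?_
    by_contra! hlow
    have hvc := hlv v hv
    -- If the cut point were strictly inside the halfspace at `v`, sliding it towards `v` by the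
    -- fraction `ε` would reach `l v = c v`. The other halfspaces contain `v` and the cut point, so
    -- a second point of the edge would survive.
    have hε : 0 < (c v - l v (p v w)) / (l v v - l v (p v w)) :=
      div_pos (by linarith) (by linarith)
    have hε1 : (c v - l v (p v w)) / (l v v - l v (p v w)) < 1 := by
      rw [div_lt_one (by linarith)]
      linarith
    have hmul : (c v - l v (p v w)) / (l v v - l v (p v w)) * (l v v - l v (p v w)) =
        c v - l v (p v w) := div_mul_cancel₀ _ (by linarith)
    set ε := (c v - l v (p v w)) / (l v v - l v (p v w))
    have hseg : ∀ {s : Set E}, Convex ℝ s → v ∈ s → p v w ∈ s →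
        (1 - ε) • p v w + ε • v ∈ s := fun hs h1 h2 =>
      hs h2 h1 (by linarith) hε.le (by ring)
    have hxe : (1 - ε) • p v w + ε • v ∈ convexHull ℝ {v, w} := by
      refine hseg (convex_convexHull ℝ _) (subset_convexHull ℝ _ (by simp)) ?_
      rw [convexHull_pair]
      exact openSegment_subset_segment ℝ v w (hpseg ha)
    have hxQ : (1 - ε) • p v w + ε • v ∈ Q := by
      rw [hQmem]
      refine ⟨?_, fun u hu => ?_⟩
      · have hPc : Convex ℝ P := hP ▸ convex_convexHull ℝ V
        exact hseg hPc (hP ▸ subset_convexHull ℝ V hv) hp.1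
      · by_cases huv : v = u
        · subst huv
          simp only [map_add, map_smul, smul_eq_mul]
          linarith
        · exact hseg (convex_halfSpace_le (l u).isLinear (c u)) (hlt hu hv huv).le (hp.2 u hu)
    have hx : (1 - ε) • p v w + ε • v = p v w := by
      have : (1 - ε) • p v w + ε • v ∈ Q ∩ convexHull ℝ {v, w} := ⟨hxQ, hxe⟩
      rw [hqQ _ (hface ha)] at this
      exact this
    have := congrArg (l v) hx
    simp only [map_add, map_smul, smul_eq_mul] at this
    linarith
  have htr : IsTruncation V l c p :=
    ⟨hV.finite, hV.vertex, hpseg, fun v w => by simp only [p, Set.pair_comm], fun hv => hlv _ hv,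
      hlt, heq⟩
  refine ⟨l, c, p, htr, ?_⟩
  rw [← htr.inter_eq_convexHull, ← hP]
  ext x
  exact hQmem x

end SimplicialFour

end Polytope

theorem mainTheorem5 (n : ℕ) (P Q : Set (EuclideanSpace ℝ (Fin n)))
    (hP : Polytope.IsSimplicialPolytope 4 P) (hQ : Polytope.IsDeepVertexTruncation P Q) :
    Polytope.IsPolytope 4 Q ∧
    Polytope.IsHSimple 4 2 Q ∧
    Polytope.IsKSimplicial 2 Q := by
  obtain ⟨hV, hPV⟩ := hP.exists_vertexSet
  obtain ⟨l, c, p, h, rfl⟩ := hQ.exists_isTruncation hV hPV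
  exact ⟨h.isPolytope hV, h.isHSimple hV, h.isKSimplicial hV⟩
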